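/- Let $V=\mathbb R^4$ (the 1-forms of Minkowski spacetime, identified with spacetime by position forms) have basis $\gamma_0,\dots,\gamma_3$, scalar product $\gamma_\mu\cdot\gamma_\nu=\eta_{\mu\nu}=\mathrm{diag}(1,-1,-1,-1)$ and reciprocal basis $\gamma^\mu$. Let $\Lambda=\bigoplus_{p=0}^4\Lambda^p$ be its Clifford algebra, with exterior product $\wedge$, left contraction $\lrcorner$, commutator product $A\times B=\tfrac12(AB-BA)$ and scalar product $A\cdot B=\langle A\tilde B\rangle_0$. For a set of grades $S\subseteq\{0,\dots,4\}$ let $\langle A\rangle_S$ be the part of $A$ with grades in $S$, and $\Lambda^S=\{A:\langle A\rangle_S=A\}$. Let $U\subseteq V$ be open and let $h$ be a smooth field on $U$ of invertible linear maps $h_x:V\to V$ (gauge metric extensor field); put $h^\star=(h^{-1})^\dagger$, the adjoint being taken with respect to $\cdot$. Let $D_a$ be the Levi-Civita covariant derivative of the metric $g(a,b)=h(a)\cdot h(b)$, let $\mathcal D_a n=h(D_a h^{-1}(n))$ for 1-form fields $n$, let $\Omega(a)=-\tfrac12\sum_\nu\gamma^\nu\wedge\mathcal D_a\gamma_\nu$,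 and for smooth multiform fields $X:U\to\Lambda$ put $\mathcal D_aX=a\cdot\partial X+\Omega(a)\times X$ and $$\mathcal D\lrcorner X=\sum_\mu h^\star(\gamma^\mu)\lrcorner\mathcal D_{\gamma_\mu}X,\quad \mathcal D\wedge X=\sum_\mu h^\star(\gamma^\mu)\wedge\mathcal D_{\gamma_\mu}X,\quad \mathcal DX=\sum_\mu h^\star(\gamma^\mu)\,\mathcal D_{\gamma_\mu}X .$$ Let $X:U\to\Lambda^S$ be a smooth field, let $\mathcal D{*}X$ be one of $\mathcal D\lrcorner X$, $\mathcal D\wedge X$, $\mathcal DX$, and let $T$ be correspondingly the set of grades $S-1$, $S+1$ or $(S-1)\cup(S+1)$ (within $\{0,\dots,4\}$). Let $\ell$ be a real function of two multiform variables, of class $C^2$ near the points $(X(x),\mathcal D{*}X(x))$, $x\in U$. Let $\partial_X\ell$ and $\partial_{\mathcal D*X}\ell$ be its multiform derivatives at $(X,\mathcal D{*}X)$ with respect to the first and the second variable, that is, the partial gradients in $\Lambda^S$ and in $\Lambda^T$ with respect to the scalar product $\cdot$. Suppose that $\det(h)\,\ell(X,\mathcal D{*}X)$ is integrable on $U$ and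 that the action is stationary at $X$: for every smooth $A:V\to\Lambda^S$ with compact support contained in $U$, $$\frac{d}{d\lambda}\Big|_{\lambda=0}\int_U\det(h)\,\ell\big(X+\lambda A,\mathcal D{*}X+\lambda\,\mathcal D{*}A\big)\,d^4x=0 .$$ Then the following holds on $U$. (a) If $*$ is $\lrcorner$: $\ \partial_X\ell-\mathcal D\wedge\partial_{\mathcal D\lrcorner X}\ell=0$. (b) If $*$ is $\wedge$: $\ \partial_X\ell-\mathcal D\lrcorner\,\partial_{\mathcal D\wedge X}\ell=0$. (c) If $*$ is the Clifford product: $\ \langle\partial_X\ell-\mathcal D\,\partial_{\mathcal DX}\ell\rangle_S=0$; and $\ \partial_X\ell-\mathcal D\,\partial_{\mathcal DX}\ell=0$ whenever $S$ contains, with a grade $p$, all grades in $\{0,\dots,4\}$ of the same parity as $p$ (in particular for general, for even and for odd multiform fields). -/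

import Mathlib

open MeasureTheory
open scoped ContDiff

noncomputable section

namespace GaugeELE

/-- The Minkowski vector space of 1-forms; `a : Form1` has the components `a μ` in the
basis `γ_0, γ_1, γ_2, γ_3`. By means of position forms it also plays the role of spacetime, with
`volume` the measure `d⁴x`. -/
abbrev Form1 : Type := Fin 4 → ℝ

/-- The diagonal entries `η_{μμ} = η^{μμ}` of the Minkowski metric `diag(1, -1, -1, -1)`. -/
def eta (μ : Fin 4) : ℝ := if μ = 0 then 1 else -1

/-- The quadratic form `a ↦ a · a`. -/
def minkowskiQ : QuadraticForm ℝ Form1 := QuadraticMap.weightedSumSquares ℝ eta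

/-- The scalar product `(a, b) ↦ a · b` of 1-forms. -/
def dotForm : LinearMap.BilinForm ℝ Form1 := QuadraticMap.associated minkowskiQ

/-- The basis `γ_μ`. -/
def gammaLow (μ : Fin 4) : Form1 := Pi.single μ 1

/-- The reciprocal basis `γ^μ = η^{μν} γ_ν`. -/
def gammaUp (μ : Fin 4) : Form1 := eta μ • gammaLow μ

/-! ### Multiforms -/

/-- The spacetime algebra, whose elements are the multiforms. -/
abbrev Multiform : Type := CliffordAlgebra minkowskiQ

/-- The canonical linear isomorphism of the spacetime algebra with the exterior algebra. -/
def toExterior : Multiform ≃ₗ[ℝ] ExteriorAlgebra ℝ Form1 := CliffordAlgebra.equivExterior minkowskiQ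

/-- The basis of blades `γ_I = γ_{i₁} ∧ ⋯ ∧ γ_{iₖ}`, where `I = {i₁ < ⋯ < iₖ}`. -/
def blade : Module.Basis (Finset (Fin 4)) ℝ Multiform :=
  (Pi.basisFun ℝ (Fin 4)).ExteriorAlgebra.map toExterior.symm

/-- Multiforms form a 16-dimensional space; they are normed by their components in the
basis of blades (all norms are equivalent). -/
instance : NormedAddCommGroup Multiform :=
  NormedAddCommGroup.induced Multiform (Finset (Fin 4) → ℝ) blade.equivFun blade.equivFun.injective

instance : NormedSpace ℝ Multiform :=
  NormedSpace.induced ℝ Multiform (Finset (Fin 4) → ℝ) blade.equivFun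

/-- The reciprocal blades `γ^I = γ^{i₁} ∧ ⋯ ∧ γ^{iₖ}`. -/
def bladeUp (I : Finset (Fin 4)) : Multiform := (∏ i ∈ I, eta i) • blade I

/-- A 1-form as a multiform. -/
def ofForm1 : Form1 →ₗ[ℝ] Multiform := CliffordAlgebra.ι minkowskiQ

/-- The exterior product. -/
def wedge (X Y : Multiform) : Multiform := toExterior.symm (toExterior X * toExterior Y)

/-- The left contraction `a ⌟ X` of a multiform by a 1-form. -/
def contract (a : Form1) (X : Multiform) : Multiform := CliffordAlgebra.contractLeft (dotForm a) X

/-- The commutator product `X × Y = (XY - YX)/2`. -/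
def commutator (X Y : Multiform) : Multiform := (1 / 2 : ℝ) • (X * Y - Y * X)

/-- The part `⟨X⟩_S` of `X` with grades in `S`. -/
def gradePart (S : Finset ℕ) (X : Multiform) : Multiform :=
  ∑ I : Finset (Fin 4), if I.card ∈ S then blade.repr X I • blade I else 0

/-- The grades of `a ⌟ X` for `X` with grades in `S`. -/
def lowerGrades (S : Finset ℕ) : Finset ℕ := (Finset.range 5).filter fun p => p + 1 ∈ S

/-- The grades of `a ∧ X` for `X` with grades in `S`. -/
def raiseGrades (S : Finset ℕ) : Finset ℕ := (Finset.range 5).filter fun p => ∃ q ∈ S, p = q + 1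

/-- The multiform derivative `∂_X f` at `X` of a scalar function of a multiform variable with
grades in `S`: the multiform with grades in `S` such that `B · ∂_X f` is, for all `B` with grades
in `S`, the derivative of `f` at `X` in the direction `B`. Here `X · Y = ⟨X Ỹ⟩₀`, for which
`γ^I · γ_J = δ_{IJ}`. -/
def multiformDeriv (S : Finset ℕ) (f : Multiform → ℝ) (X : Multiform) : Multiform :=
  ∑ I : Finset (Fin 4), if I.card ∈ S then fderiv ℝ f X (blade I) • bladeUp I else 0

/-! ### The gauge covariant derivative -/

/-- The adjoint `t†` of a (1,1)-extensor: `t†(a) · b = a · t(b)`. -/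
def adj (t : Form1 →L[ℝ] Form1) (a : Form1) : Form1 := ∑ μ, dotForm a (t (gammaLow μ)) • gammaUp μ

/-- `h^⋆ = (h⁻¹)†`. -/
def hStar (h : Form1 → Form1 →L[ℝ] Form1) (x a : Form1) : Form1 := adj (h x).inverse a

/-- The metric `g(a, b) = h(a) · h(b)` at `x`. -/
def gaugeMetric (h : Form1 → Form1 →L[ℝ] Form1) (x a b : Form1) : ℝ := dotForm (h x a) (h x b)

/-- The Christoffel symbols of the metric `g`: the 1-form `Γ(a, b)` with
`g(Γ(a, b), c) = (a·∂ g(b, c) + b·∂ g(a, c) - c·∂ g(a, b)) / 2` for all constant `c`.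
(The 1-forms `h⁻¹(h^⋆(γ^μ))` are the `g`-reciprocals of the `γ_μ`.) -/
def christoffel (h : Form1 → Form1 →L[ℝ] Form1) (x a b : Form1) : Form1 :=
  (1 / 2 : ℝ) • ∑ μ,
    (fderiv ℝ (fun y => gaugeMetric h y b (gammaLow μ)) x a
      + fderiv ℝ (fun y => gaugeMetric h y a (gammaLow μ)) x b
      - fderiv ℝ (fun y => gaugeMetric h y a b) x (gammaLow μ))
    • (h x).inverse (hStar h x (gammaUp μ))

/-- The Levi-Civita directional covariant derivative `D_a Y` of the metric `g`, on 1-form fields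
(identified with vector fields by means of the Minkowski metric). -/
def leviCivita (h : Form1 → Form1 →L[ℝ] Form1) (a : Form1) (Y : Form1 → Form1) (x : Form1) :
    Form1 :=
  fderiv ℝ Y x a + christoffel h x a (Y x)

/-- The gauge covariant derivative `h(D_a h⁻¹(n))` of a 1-form field `n`. -/
def gaugeDerivForm1 (h : Form1 → Form1 →L[ℝ] Form1) (a : Form1) (n : Form1 → Form1) (x : Form1) :
    Form1 :=
  h x (leviCivita h a (fun y => (h y).inverse (n y)) x)

/-- The second connection extensor field `Ω(a) = -(1/2) ∂_n ∧ 𝒟_a n`. -/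
def Omega (h : Form1 → Form1 →L[ℝ] Form1) (x a : Form1) : Multiform :=
  (-(1 / 2) : ℝ) • ∑ ν,
    wedge (ofForm1 (gammaUp ν)) (ofForm1 (gaugeDerivForm1 h a (fun _ => gammaLow ν) x))

/-- The gauge covariant derivative `𝒟_a X = a·∂X + Ω(a) × X` of a multiform field. -/
def gaugeDeriv (h : Form1 → Form1 →L[ℝ] Form1) (a : Form1) (X : Form1 → Multiform) (x : Form1) :
    Multiform :=
  fderiv ℝ X x a + commutator (Omega h x a) (X x)

/-- The `h`-divergence `𝒟 ⌟ X = h^⋆(∂_a) ⌟ 𝒟_a X`. -/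
def hDiv (h : Form1 → Form1 →L[ℝ] Form1) (X : Form1 → Multiform) (x : Form1) : Multiform :=
  ∑ μ, contract (hStar h x (gammaUp μ)) (gaugeDeriv h (gammaLow μ) X x)

/-- The `h`-curl `𝒟 ∧ X = h^⋆(∂_a) ∧ 𝒟_a X`. -/
def hCurl (h : Form1 → Form1 →L[ℝ] Form1) (X : Form1 → Multiform) (x : Form1) : Multiform :=
  ∑ μ, wedge (ofForm1 (hStar h x (gammaUp μ))) (gaugeDeriv h (gammaLow μ) X x)

/-- The `h`-gradient `𝒟X = h^⋆(∂_a) 𝒟_a X`. -/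
def hGrad (h : Form1 → Form1 →L[ℝ] Form1) (X : Form1 → Multiform) (x : Form1) : Multiform :=
  ∑ μ, ofForm1 (hStar h x (gammaUp μ)) * gaugeDeriv h (gammaLow μ) X x

/-! ### Action -/

/-- The Lagrangian scalar field `det(h) ℓ(X, 𝒟*X)`; `Dstar` is one of `hDiv h`, `hCurl h`,
`hGrad h`. -/
def lagrangian (h : Form1 → Form1 →L[ℝ] Form1) (Dstar : (Form1 → Multiform) → Form1 → Multiform)
    (l : Multiform × Multiform → ℝ) (X : Form1 → Multiform) (x : Form1) : ℝ :=
  (h x).det * l (X x, Dstar X x)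

/-- The action `∫_U det(h) ℓ(X, 𝒟*X) d⁴x`. -/
def action (U : Set Form1) (h : Form1 → Form1 →L[ℝ] Form1)
    (Dstar : (Form1 → Multiform) → Form1 → Multiform)
    (l : Multiform × Multiform → ℝ) (X : Form1 → Multiform) : ℝ :=
  ∫ x in U, lagrangian h Dstar l X x

/-- The condition of stationary action for fields with grades in `S`: the action of `X` on `U` is
a convergent integral, and `S'(0) = 0` for the varied action `S(t)` of `X + tA`, for all smooth
`A` with grades in `S` and compact support inside `U`. -/
def IsStationary (S : Finset ℕ) (U : Set Form1) (h : Form1 → Form1 →L[ℝ] Form1)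
    (Dstar : (Form1 → Multiform) → Form1 → Multiform)
    (l : Multiform × Multiform → ℝ) (X : Form1 → Multiform) : Prop :=
  IntegrableOn (lagrangian h Dstar l X) U ∧
  ∀ A : Form1 → Multiform, ContDiff ℝ ∞ A → (∀ x, gradePart S (A x) = A x) →
    HasCompactSupport A → tsupport A ⊆ U →
    HasDerivAt (fun t : ℝ => action U h Dstar l (X + t • A)) 0 0

/-- `∂_X ℓ(X, 𝒟*X)` as a multiform field. -/
def derivFst (S : Finset ℕ) (Dstar : (Form1 → Multiform) → Form1 → Multiform)
    (l : Multiform × Multiform → ℝ) (X : Form1 → Multiform) (x : Form1) : Multiform :=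
  multiformDeriv S (fun Z => l (Z, Dstar X x)) (X x)

/-- `∂_{𝒟*X} ℓ(X, 𝒟*X)` as a multiform field, where `T` is the set of grades of `𝒟*X`. -/
def derivSnd (T : Finset ℕ) (Dstar : (Form1 → Multiform) → Form1 → Multiform)
    (l : Multiform × Multiform → ℝ) (X : Form1 → Multiform) (x : Form1) : Multiform :=
  multiformDeriv T (fun Z => l (X x, Z)) (Dstar X x)

end GaugeELE

end

open GaugeELE

noncomputable section

namespace GaugeELE

/-! All three cases are one statement about an operator `covDeriv m h`, with `m` one of contraction,
exterior product or Clifford product by a 1-form. What distinguishes them is the adjoint `m'` of `m`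
for the scalar product of multiforms: contraction and exterior product are adjoint to each other
(`scalarProd_contractL`), and their sum, the Clifford product, is self-adjoint (`scalarProd_mulL`).

Vary `X` by `φ • B` with `B` a constant multiform of grades in `S` and `φ` a bump function. The
first variation has the density `det h · (φ B · ∂_X ℓ + (𝒟*(φB)) · Y)`, where `Y` is the derivative
of `ℓ` in its second variable. The point is that `covDeriv m h` and `covDeriv m' h` are negatives of
adjoints of each other for the weight `det h`: `scalarProd_covDeriv_add` says that the sum of the
two pairings is the coordinate divergence of a current. Three facts carry it. The commutator with
the bivector `Ω` is antisymmetric for the scalar product. It is a derivation of each of the products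
and acts on 1-forms as the connection (`commutator_Omega_leibniz`). The frame `h^⋆(γ^μ)` weighted by
`det h` is covariantly divergence-free (`sum_fderiv_det_smul_hStar`), which combines metric
compatibility of the Levi-Civita connection with Jacobi's formula for the trace of its Christoffel
symbols.

The divergence integrates to zero because `φ` has compact support in `U`, and the fundamental lemma
of the calculus of variations gives the equation tested against every `B` with grades in `S`, that
is, its projection onto `Λ^S`. The projection can be dropped when `m'` maps `Λ^T` back into `Λ^S`:
always in (a) and (b), and under the parity condition in (c). -/

instance : FiniteDimensional ℝ Multiform := blade.finiteDimensional_of_finite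

/-! ### Coordinates for the Minkowski scalar product. -/

theorem eta_mul_self (μ : Fin 4) : eta μ * eta μ = 1 := by
  unfold eta; split_ifs <;> norm_num

theorem eta_ne_zero (μ : Fin 4) : eta μ ≠ 0 := by
  unfold eta; split_ifs <;> norm_num

theorem dotForm_apply (a b : Form1) : dotForm a b = ∑ μ, eta μ * (a μ * b μ) := by
  simp only [dotForm, minkowskiQ, QuadraticMap.associated_apply,
    QuadraticMap.weightedSumSquares_apply, Pi.add_apply, smul_eq_mul, ← Finset.sum_sub_distrib,
    Finset.smul_sum, Module.End.smul_def]
  refine Finset.sum_congr rfl fun μ _ => ?_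
  simp
  ring

theorem dotForm_comm (a b : Form1) : dotForm a b = dotForm b a := by
  simp only [dotForm_apply, mul_comm (a _)]

theorem dotForm_gammaUp (μ : Fin 4) (a : Form1) : dotForm (gammaUp μ) a = a μ := by
  rw [dotForm_apply, Finset.sum_eq_single μ]
  · simp [gammaUp, gammaLow, ← mul_assoc, eta_mul_self]
  · intro ν _ hν
    simp [gammaUp, gammaLow, hν]
  · simp

theorem dotForm_gammaLow (μ : Fin 4) (a : Form1) : dotForm (gammaLow μ) a = eta μ * a μ := by
  rw [← dotForm_gammaUp μ a, gammaUp, map_smul, LinearMap.smul_apply, smul_eq_mul, ← mul_assoc,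
    eta_mul_self, one_mul]

theorem sum_smul_gammaLow (a : Form1) : ∑ μ, a μ • gammaLow μ = a := by
  ext ν
  simp [gammaLow, Finset.sum_apply, Pi.single_apply]

theorem sum_dotForm_smul_gammaUp (a : Form1) : ∑ μ, dotForm a (gammaLow μ) • gammaUp μ = a := by
  conv_rhs => rw [← sum_smul_gammaLow a]
  refine Finset.sum_congr rfl fun μ _ => ?_
  rw [dotForm_comm, dotForm_gammaLow, gammaUp, smul_smul, mul_right_comm, eta_mul_self, one_mul]

/-! ### Exterior multiplication, contraction and Clifford multiplication by a 1-form -/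

/-- The left Clifford multiplication by a 1-form. -/
def mulL : Form1 →ₗ[ℝ] Multiform →ₗ[ℝ] Multiform :=
  LinearMap.mul ℝ Multiform ∘ₗ ofForm1

/-- The left contraction by a 1-form. -/
def contractL : Form1 →ₗ[ℝ] Multiform →ₗ[ℝ] Multiform :=
  CliffordAlgebra.contractLeft ∘ₗ dotForm

/-- The left exterior multiplication by a 1-form. -/
def wedgeL : Form1 →ₗ[ℝ] Multiform →ₗ[ℝ] Multiform :=
  ((LinearMap.mul ℝ (ExteriorAlgebra ℝ Form1) ∘ₗ ExteriorAlgebra.ι ℝ).compl₂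
    toExterior.toLinearMap).compr₂ toExterior.symm.toLinearMap

theorem mulL_apply (a : Form1) (X : Multiform) : mulL a X = ofForm1 a * X := rfl

theorem toExterior_ofForm1 (a : Form1) : toExterior (ofForm1 a) = ExteriorAlgebra.ι ℝ a :=
  CliffordAlgebra.changeForm_ι CliffordAlgebra.changeForm.associated_neg_proof _

theorem toExterior_wedgeL (a : Form1) (X : Multiform) :
    toExterior (wedgeL a X) = ExteriorAlgebra.ι ℝ a * toExterior X := by
  simp [wedgeL]

theorem wedgeL_apply (a : Form1) (X : Multiform) : wedgeL a X = wedge (ofForm1 a) X := by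
  apply toExterior.injective
  rw [toExterior_wedgeL, wedge, toExterior_ofForm1, LinearEquiv.apply_symm_apply]

theorem toExterior_contractL (a : Form1) (X : Multiform) :
    toExterior (contractL a X) =
      CliffordAlgebra.contractLeft (Q := (0 : QuadraticForm ℝ Form1)) (dotForm a)
        (toExterior X) :=
  CliffordAlgebra.changeForm_contractLeft CliffordAlgebra.changeForm.associated_neg_proof _ _

/-- Passing to the exterior algebra replaces the form `Q` by `0`, hence changes it by `-Q`. The
contraction correction comes with a minus sign of its own, so the two signs cancel. -/
theorem mulL_eq (a : Form1) (X : Multiform) : mulL a X = wedgeL a X + contractL a X := by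
  apply toExterior.injective
  rw [map_add, toExterior_wedgeL, toExterior_contractL]
  refine (CliffordAlgebra.changeForm_ι_mul
    CliffordAlgebra.changeForm.associated_neg_proof _ _).trans ?_
  rw [sub_eq_add_neg]
  congr 1
  have : QuadraticMap.associated (R := ℝ) (-minkowskiQ) a = - dotForm a := by
    rw [map_neg]; rfl
  rw [this, map_neg, LinearMap.neg_apply, neg_neg]
  rfl

theorem wedgeL_wedgeL (a b : Form1) (X : Multiform) :
    wedgeL a (wedgeL b X) = - wedgeL b (wedgeL a X) := by
  apply toExterior.injective
  rw [map_neg]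
  simp only [toExterior_wedgeL, ← mul_assoc]
  rw [eq_neg_iff_add_eq_zero, ← add_mul, ExteriorAlgebra.ι_add_mul_swap, zero_mul]

theorem contractL_contractL (a b : Form1) (X : Multiform) :
    contractL a (contractL b X) = - contractL b (contractL a X) :=
  CliffordAlgebra.contractLeft_comm _ _ _

theorem contractL_wedgeL (a b : Form1) (X : Multiform) :
    contractL a (wedgeL b X) = dotForm a b • X - wedgeL b (contractL a X) := by
  apply toExterior.injective
  rw [map_sub, map_smul]
  simp only [toExterior_wedgeL, toExterior_contractL]
  exact CliffordAlgebra.contractLeft_ι_mul _ _ _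

/-! ### The commutator product with a bivector -/

theorem commutator_mul (B X Y : Multiform) :
    commutator B (X * Y) = commutator B X * Y + X * commutator B Y := by
  simp only [commutator, smul_mul_assoc, mul_smul_comm, ← smul_add]
  congr 1
  noncomm_ring

theorem wedge_ofForm1_ofForm1 (a b : Form1) :
    wedge (ofForm1 a) (ofForm1 b) =
      ofForm1 a * ofForm1 b - algebraMap ℝ Multiform (dotForm a b) := by
  rw [← wedgeL_apply, eq_sub_iff_add_eq, ← mulL_apply, mulL_eq]
  congr 1
  exact (CliffordAlgebra.contractLeft_ι _ _ _).symm

theorem ofForm1_mul_add (a b : Form1) :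
    ofForm1 a * ofForm1 b + ofForm1 b * ofForm1 a =
      algebraMap ℝ Multiform (2 * dotForm a b) := by
  refine (CliffordAlgebra.ι_mul_ι_add_swap a b).trans ?_
  congr 1
  simp [dotForm, QuadraticMap.associated_apply,
    QuadraticMap.polar]

theorem commutator_wedge_ofForm1 (a b v : Form1) :
    commutator (wedge (ofForm1 a) (ofForm1 b)) (ofForm1 v) =
      ofForm1 (dotForm b v • a - dotForm a v • b) := by
  have h1 := ofForm1_mul_add b v
  have h2 := ofForm1_mul_add a v
  have h3 : ∀ r : ℝ, algebraMap ℝ Multiform r * ofForm1 v = ofForm1 v * algebraMap ℝ Multiform r :=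
    fun r => Algebra.commutes r _
  rw [commutator, wedge_ofForm1_ofForm1, sub_mul, mul_sub, h3, sub_sub_sub_cancel_right]
  -- The scalar part of `ab` is central and has dropped out. Inserting `avb` with both signs leaves
  -- only anticommutators, which are scalars.
  have h4 : ofForm1 a * ofForm1 b * ofForm1 v - ofForm1 v * (ofForm1 a * ofForm1 b) =
      ofForm1 a * (ofForm1 b * ofForm1 v + ofForm1 v * ofForm1 b)
        - (ofForm1 a * ofForm1 v + ofForm1 v * ofForm1 a) * ofForm1 b := by noncomm_ring
  rw [h4, h1, h2, ← Algebra.commutes, ← Algebra.smul_def, ← Algebra.smul_def, map_sub, map_smul,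
    map_smul, smul_sub, smul_smul, smul_smul]
  congr 2 <;> ring

/-- By induction on Clifford products by a 1-form, since both sides satisfy the Leibniz rule. In
this form, preservation of grades and antisymmetry for the scalar product are immediate. -/
theorem commutator_wedge (a b : Form1) (X : Multiform) :
    commutator (wedge (ofForm1 a) (ofForm1 b)) X =
      wedgeL a (contractL b X) - wedgeL b (contractL a X) := by
  induction X using CliffordAlgebra.left_induction with
  | algebraMap r =>
    have h1 : ∀ c, contractL c (algebraMap ℝ Multiform r) = 0 :=
      fun c => CliffordAlgebra.contractLeft_algebraMap _ _ _
    rw [h1, h1, map_zero, map_zero, commutator, Algebra.commutes, sub_self, sub_self, smul_zero]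
  | add X Y hX hY =>
    have h1 : ∀ B : Multiform, commutator B (X + Y) = commutator B X + commutator B Y := by
      intro B
      simp only [commutator, ← smul_add]; congr 1; noncomm_ring
    rw [h1, hX, hY]
    simp only [map_add]
    abel
  | ι_mul X v hX =>
    change commutator _ (ofForm1 v * X) = wedgeL a (contractL b (mulL v X)) -
      wedgeL b (contractL a (mulL v X))
    rw [commutator_mul, hX, commutator_wedge_ofForm1, ← mulL_apply, ← mulL_apply]
    simp only [mulL_eq, map_add, map_sub, map_smul, contractL_wedgeL, LinearMap.sub_apply,
      LinearMap.smul_apply]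
    rw [wedgeL_wedgeL v a, wedgeL_wedgeL v b, contractL_contractL v b, contractL_contractL v a,
      map_neg, map_neg, dotForm_comm v a, dotForm_comm v b]
    module

/-! ### Blades -/

theorem toExterior_blade (I : Finset (Fin 4)) :
    toExterior (blade I) = (Pi.basisFun ℝ (Fin 4)).ExteriorAlgebra I := by
  simp [blade]

theorem exteriorAlgebra_basis_singleton (μ : Fin 4) :
    (Pi.basisFun ℝ (Fin 4)).ExteriorAlgebra {μ} = ExteriorAlgebra.ι ℝ (gammaLow μ) := by
  rw [ExteriorAlgebra.basis_apply_ofCard _ (Finset.card_singleton μ)]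
  have h : ((Set.powersetCard.ofFinEmbEquiv.symm
      (Set.powersetCard.ofCard (Finset.card_singleton μ))) 0) ∈ ({μ} : Finset (Fin 4)) :=
    Finset.orderEmbOfFin_mem _ _ _
  rw [Finset.mem_singleton] at h
  simp [ExteriorAlgebra.ιMulti_family, h, gammaLow]

theorem wedgeL_blade_of_mem {μ : Fin 4} {I : Finset (Fin 4)} (hμ : μ ∈ I) :
    wedgeL (gammaLow μ) (blade I) = 0 := by
  apply toExterior.injective
  rw [toExterior_wedgeL, toExterior_blade, ← exteriorAlgebra_basis_singleton, map_zero]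
  exact ExteriorAlgebra.basis_mul_of_not_disjoint _
    (Set.powersetCard.ofCard (Finset.card_singleton μ)) (Set.powersetCard.ofCard (s := I) rfl)
    (by simpa using hμ)

/-- The sign of the reordering permutation is kept abstract: only its square is ever needed. -/
theorem wedgeL_blade_of_notMem {μ : Fin 4} {I : Finset (Fin 4)} (hμ : μ ∉ I) :
    ∃ ε : ℝ, ε * ε = 1 ∧ wedgeL (gammaLow μ) (blade I) = ε • blade (insert μ I) := by
  have hd : Disjoint (Set.powersetCard.ofCard (Finset.card_singleton μ)).val
      (Set.powersetCard.ofCard (s := I) rfl).val := by simpa using hμ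
  have key := ExteriorAlgebra.basis_mul_of_disjoint (Pi.basisFun ℝ (Fin 4)) _ _ hd
  refine ⟨((Equiv.Perm.sign (Set.powersetCard.permOfDisjoint hd) : ℤ) : ℝ), ?_, ?_⟩
  · rw [← Int.cast_mul, ← Units.val_mul, Int.units_mul_self]
    simp
  · apply toExterior.injective
    rw [toExterior_wedgeL, map_smul, toExterior_blade, toExterior_blade,
      ← exteriorAlgebra_basis_singleton]
    refine key.trans ?_
    rw [Int.cast_smul_eq_zsmul, Units.smul_def]
    congr 2
    simp [Set.powersetCard.disjUnion]

theorem contractL_blade_of_notMem {μ : Fin 4} {I : Finset (Fin 4)} (hμ : μ ∉ I) :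
    contractL (gammaLow μ) (blade I) = 0 := by
  induction I using Finset.induction_on with
  | empty =>
    apply toExterior.injective
    rw [toExterior_contractL, toExterior_blade, map_zero, ExteriorAlgebra.basis_apply_ofCard _
      Finset.card_empty, ExteriorAlgebra.ιMulti_family, ExteriorAlgebra.ιMulti_zero_apply]
    exact CliffordAlgebra.contractLeft_one _ _
  | insert ν J hν ih =>
    obtain ⟨ε, hε, h1⟩ := wedgeL_blade_of_notMem hν
    have h2 : blade (insert ν J) = ε • wedgeL (gammaLow ν) (blade J) := by
      rw [h1, smul_smul, hε, one_smul]
    rw [Finset.mem_insert, not_or] at hμ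
    rw [h2, map_smul, contractL_wedgeL, ih hμ.2, dotForm_gammaLow]
    simp [gammaLow, hμ.1]

/-- It matters that the same `ε` occurs in both formulas: this is adjointness of the two operations
on blades. -/
theorem contractL_blade_insert {μ : Fin 4} {I : Finset (Fin 4)} (hμ : μ ∉ I) :
    ∃ ε : ℝ, wedgeL (gammaLow μ) (blade I) = ε • blade (insert μ I) ∧
      contractL (gammaLow μ) (blade (insert μ I)) = (ε * eta μ) • blade I := by
  obtain ⟨ε, hε, h1⟩ := wedgeL_blade_of_notMem hμ
  have h2 : blade (insert μ I) = ε • wedgeL (gammaLow μ) (blade I) := by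
    rw [h1, smul_smul, hε, one_smul]
  refine ⟨ε, h1, ?_⟩
  rw [h2, map_smul, contractL_wedgeL, contractL_blade_of_notMem hμ, dotForm_gammaLow]
  simp [gammaLow, smul_smul]

/-! ### The scalar product of multiforms -/

/-- The scalar product of multiforms, for which the blades are orthogonal with
`γ_I · γ_I = ∏ i ∈ I, η_{ii}`. -/
def scalarProd : LinearMap.BilinForm ℝ Multiform :=
  ∑ I, (∏ i ∈ I, eta i) • (LinearMap.mul ℝ ℝ).compl₁₂ (blade.coord I) (blade.coord I)

theorem scalarProd_apply (X Y : Multiform) :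
    scalarProd X Y = ∑ I, (∏ i ∈ I, eta i) * (blade.repr X I * blade.repr Y I) := by
  simp [scalarProd, LinearMap.sum_apply]

theorem scalarProd_blade_left (I : Finset (Fin 4)) (Y : Multiform) :
    scalarProd (blade I) Y = (∏ i ∈ I, eta i) * blade.repr Y I := by
  rw [scalarProd_apply, Finset.sum_eq_single I]
  · simp
  · intro J _ hJ
    simp [hJ.symm]
  · simp

theorem scalarProd_comm (X Y : Multiform) : scalarProd X Y = scalarProd Y X := by
  simp only [scalarProd_apply, mul_comm (blade.repr X _)]

theorem prod_eta_mul_self (I : Finset (Fin 4)) : (∏ i ∈ I, eta i) * (∏ i ∈ I, eta i) = 1 := by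
  rw [← Finset.prod_mul_distrib]
  exact Finset.prod_eq_one fun i _ => eta_mul_self i

theorem scalarProd_bladeUp_right (X : Multiform) (I : Finset (Fin 4)) :
    scalarProd X (bladeUp I) = blade.repr X I := by
  rw [bladeUp, map_smul, scalarProd_comm, scalarProd_blade_left, smul_eq_mul, ← mul_assoc,
    prod_eta_mul_self, one_mul]

theorem scalarProd_blade_blade (I J : Finset (Fin 4)) :
    scalarProd (blade I) (blade J) = if I = J then ∏ i ∈ I, eta i else 0 := by
  rw [scalarProd_blade_left, Module.Basis.repr_self, Finsupp.single_apply]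
  by_cases h : J = I
  · simp [h]
  · simp [h, Ne.symm h]

theorem scalarProd_contractL_blade (μ : Fin 4) (I J : Finset (Fin 4)) :
    scalarProd (contractL (gammaLow μ) (blade I)) (blade J) =
      scalarProd (blade I) (wedgeL (gammaLow μ) (blade J)) := by
  -- Both sides vanish unless `I = insert μ J` with `μ ∉ J`; there the two sides agree because they
  -- carry the same sign `ε`.
  by_cases hI : μ ∈ I
  · obtain ⟨K, hK, rfl⟩ : ∃ K, μ ∉ K ∧ I = insert μ K :=
      ⟨I.erase μ, by simp, (Finset.insert_erase hI).symm⟩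
    obtain ⟨ε, h1, h2⟩ := contractL_blade_insert hK
    rw [h2, map_smul, LinearMap.smul_apply, scalarProd_blade_blade]
    by_cases hJ : μ ∈ J
    · rw [wedgeL_blade_of_mem hJ, map_zero, if_neg (by rintro rfl; exact hK hJ), smul_zero]
    · by_cases hKJ : K = J
      · subst hKJ
        rw [h1, map_smul, scalarProd_blade_blade, if_pos rfl, if_pos rfl, Finset.prod_insert hK]
        simp only [smul_eq_mul]; ring
      · obtain ⟨δ, -, h3⟩ := wedgeL_blade_of_notMem hJ
        rw [h3, map_smul, scalarProd_blade_blade, if_neg hKJ, if_neg, smul_zero, smul_zero]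
        intro h
        apply hKJ
        rw [← Finset.erase_insert hK, h, Finset.erase_insert hJ]
  · rw [contractL_blade_of_notMem hI, map_zero, LinearMap.zero_apply]
    by_cases hJ : μ ∈ J
    · rw [wedgeL_blade_of_mem hJ, map_zero]
    · obtain ⟨δ, -, h3⟩ := wedgeL_blade_of_notMem hJ
      rw [h3, map_smul, scalarProd_blade_blade, if_neg, smul_zero]
      rintro rfl
      simp at hI

theorem scalarProd_contractL (a : Form1) (X Y : Multiform) :
    scalarProd (contractL a X) Y = scalarProd X (wedgeL a Y) := by
  have h : (scalarProd.compl₁₂ (contractL a) LinearMap.id) =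
      scalarProd.compl₁₂ LinearMap.id (wedgeL a) := by
    refine blade.ext fun I => blade.ext fun J => ?_
    simp only [LinearMap.compl₁₂_apply, LinearMap.id_apply]
    rw [← sum_smul_gammaLow a]
    simp only [map_sum, map_smul, LinearMap.sum_apply, LinearMap.smul_apply,
      scalarProd_contractL_blade]
  exact LinearMap.congr_fun (LinearMap.congr_fun h X) Y

theorem scalarProd_wedgeL (a : Form1) (X Y : Multiform) :
    scalarProd (wedgeL a X) Y = scalarProd X (contractL a Y) := by
  rw [scalarProd_comm, ← scalarProd_contractL, scalarProd_comm]

theorem scalarProd_mulL (a : Form1) (X Y : Multiform) :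
    scalarProd (mulL a X) Y = scalarProd X (mulL a Y) := by
  rw [mulL_eq, mulL_eq, map_add, map_add, LinearMap.add_apply, scalarProd_wedgeL,
    scalarProd_contractL, add_comm]

/-! ### Grades -/

/-- The space of multiforms with grades in `S`. -/
def gradeSpace (S : Finset ℕ) : Submodule ℝ Multiform where
  carrier := {X | ∀ I : Finset (Fin 4), I.card ∉ S → blade.repr X I = 0}
  add_mem' hX hY I hI := by simp [hX I hI, hY I hI]
  zero_mem' I hI := by simp
  smul_mem' c X hX I hI := by simp [hX I hI]

theorem mem_gradeSpace {S : Finset ℕ} {X : Multiform} :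
    X ∈ gradeSpace S ↔ ∀ I : Finset (Fin 4), I.card ∉ S → blade.repr X I = 0 := Iff.rfl

theorem repr_gradePart (S : Finset ℕ) (X : Multiform) (I : Finset (Fin 4)) :
    blade.repr (gradePart S X) I = if I.card ∈ S then blade.repr X I else 0 := by
  rw [gradePart, map_sum, Finsupp.finsetSum_apply, Finset.sum_eq_single I]
  · split_ifs <;> simp
  · intro J _ hJ
    split_ifs <;> simp [hJ]
  · simp

theorem gradePart_eq_self_iff {S : Finset ℕ} {X : Multiform} :
    gradePart S X = X ↔ X ∈ gradeSpace S := by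
  rw [mem_gradeSpace]
  constructor
  · intro h I hI
    rw [← h, repr_gradePart, if_neg hI]
  · intro h
    refine blade.repr.injective (Finsupp.ext fun I => ?_)
    rw [repr_gradePart]
    split_ifs with hI
    · rfl
    · exact (h I hI).symm

theorem blade_mem_gradeSpace {S : Finset ℕ} {I : Finset (Fin 4)} (hI : I.card ∈ S) :
    blade I ∈ gradeSpace S := by
  intro J hJ
  rw [Module.Basis.repr_self, Finsupp.single_apply, if_neg]
  rintro rfl
  exact hJ hI

theorem gradeSpace_mono {S T : Finset ℕ} (h : S ⊆ T) : gradeSpace S ≤ gradeSpace T :=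
  fun _ hX I hI => hX I fun hS => hI (h hS)

theorem map_mem_gradeSpace {S T : Finset ℕ} {f : Multiform →ₗ[ℝ] Multiform}
    (hf : ∀ I : Finset (Fin 4), I.card ∈ S → f (blade I) ∈ gradeSpace T) {X : Multiform}
    (hX : X ∈ gradeSpace S) : f X ∈ gradeSpace T := by
  rw [← blade.sum_repr X, map_sum]
  refine Submodule.sum_mem _ fun I _ => ?_
  rw [map_smul]
  by_cases hI : I.card ∈ S
  · exact Submodule.smul_mem _ _ (hf I hI)
  · rw [hX I hI, zero_smul]
    exact Submodule.zero_mem _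

theorem wedgeL_mem_gradeSpace (a : Form1) {S : Finset ℕ} {X : Multiform} (hX : X ∈ gradeSpace S) :
    wedgeL a X ∈ gradeSpace (raiseGrades S) := by
  refine map_mem_gradeSpace (fun I hI => ?_) hX
  rw [← sum_smul_gammaLow a, map_sum, LinearMap.sum_apply]
  refine Submodule.sum_mem _ fun μ _ => ?_
  rw [map_smul, LinearMap.smul_apply]
  refine Submodule.smul_mem _ _ ?_
  by_cases hμ : μ ∈ I
  · rw [wedgeL_blade_of_mem hμ]
    exact Submodule.zero_mem _
  · obtain ⟨ε, -, h⟩ := wedgeL_blade_of_notMem hμ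
    rw [h]
    refine Submodule.smul_mem _ _ (blade_mem_gradeSpace ?_)
    -- `raiseGrades` is cut off at grade 4, so the new blade must be seen to fit into the four
    -- indices.
    have h4 := Finset.card_le_univ (insert μ I)
    rw [Fintype.card_fin] at h4
    rw [raiseGrades, Finset.mem_filter, Finset.mem_range]
    exact ⟨by omega, _, hI, Finset.card_insert_of_notMem hμ⟩

theorem contractL_mem_gradeSpace (a : Form1) {S : Finset ℕ} {X : Multiform}
    (hX : X ∈ gradeSpace S) : contractL a X ∈ gradeSpace (lowerGrades S) := by
  refine map_mem_gradeSpace (fun I hI => ?_) hX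
  rw [← sum_smul_gammaLow a, map_sum, LinearMap.sum_apply]
  refine Submodule.sum_mem _ fun μ _ => ?_
  rw [map_smul, LinearMap.smul_apply]
  refine Submodule.smul_mem _ _ ?_
  by_cases hμ : μ ∈ I
  · obtain ⟨K, hK, rfl⟩ : ∃ K, μ ∉ K ∧ I = insert μ K :=
      ⟨I.erase μ, by simp, (Finset.insert_erase hμ).symm⟩
    obtain ⟨ε, -, h⟩ := contractL_blade_insert hK
    rw [h]
    refine Submodule.smul_mem _ _ (blade_mem_gradeSpace ?_)
    rw [Finset.card_insert_of_notMem hK] at hI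
    have h4 := Finset.card_le_univ K
    rw [Fintype.card_fin] at h4
    rw [lowerGrades, Finset.mem_filter, Finset.mem_range]
    exact ⟨by omega, hI⟩
  · rw [contractL_blade_of_notMem hμ]
    exact Submodule.zero_mem _

theorem mulL_mem_gradeSpace (a : Form1) {S : Finset ℕ} {X : Multiform} (hX : X ∈ gradeSpace S) :
    mulL a X ∈ gradeSpace (lowerGrades S ∪ raiseGrades S) := by
  rw [mulL_eq]
  exact Submodule.add_mem _
    (gradeSpace_mono Finset.subset_union_right (wedgeL_mem_gradeSpace a hX))
    (gradeSpace_mono Finset.subset_union_left (contractL_mem_gradeSpace a hX))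

theorem raiseGrades_lowerGrades_subset (S : Finset ℕ) : raiseGrades (lowerGrades S) ⊆ S := by
  intro p hp
  obtain ⟨-, q, hq, rfl⟩ := Finset.mem_filter.1 hp
  exact (Finset.mem_filter.1 hq).2

theorem lowerGrades_raiseGrades_subset (S : Finset ℕ) : lowerGrades (raiseGrades S) ⊆ S := by
  intro p hp
  simp only [raiseGrades, lowerGrades, Finset.mem_filter] at hp
  obtain ⟨-, -, q, hq, h⟩ := hp
  rwa [Nat.add_right_cancel h]

theorem commutator_wedge_mem_gradeSpace (a b : Form1) {S : Finset ℕ} {X : Multiform}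
    (hX : X ∈ gradeSpace S) :
    commutator (wedge (ofForm1 a) (ofForm1 b)) X ∈ gradeSpace S := by
  rw [commutator_wedge]
  have h : ∀ c d, wedgeL c (contractL d X) ∈ gradeSpace S := fun c d =>
    gradeSpace_mono (raiseGrades_lowerGrades_subset S)
      (wedgeL_mem_gradeSpace c (contractL_mem_gradeSpace d hX))
  exact Submodule.sub_mem _ (h a b) (h b a)

theorem multiformDeriv_mem_gradeSpace (S : Finset ℕ) (f : Multiform → ℝ) (X : Multiform) :
    multiformDeriv S f X ∈ gradeSpace S := by
  refine Submodule.sum_mem _ fun I _ => ?_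
  split_ifs with hI
  · exact Submodule.smul_mem _ _ (Submodule.smul_mem _ _ (blade_mem_gradeSpace hI))
  · exact Submodule.zero_mem _

/-- This is the defining property of the gradient, and holds because the `bladeUp I` are dual to the
blades for `scalarProd`. -/
theorem scalarProd_multiformDeriv {S : Finset ℕ} (f : Multiform → ℝ) (X : Multiform)
    {B : Multiform} (hB : B ∈ gradeSpace S) :
    scalarProd B (multiformDeriv S f X) = fderiv ℝ f X B := by
  conv_rhs => rw [← blade.sum_repr B]
  rw [multiformDeriv, map_sum, map_sum]
  refine Finset.sum_congr rfl fun I _ => ?_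
  rw [map_smul]
  split_ifs with hI
  · rw [map_smul, scalarProd_bladeUp_right, smul_eq_mul, smul_eq_mul, mul_comm]
  · rw [hB I hI, map_zero, zero_smul]

/-! ### Calculus of bilinear maps on finite-dimensional spaces -/

section Bilinear

variable {E F G H : Type*} [NormedAddCommGroup E] [NormedSpace ℝ E] [FiniteDimensional ℝ E]
  [NormedAddCommGroup F] [NormedSpace ℝ F] [FiniteDimensional ℝ F]
  [NormedAddCommGroup G] [NormedSpace ℝ G] [NormedAddCommGroup H] [NormedSpace ℝ H]

theorem contDiffAt_linear (f : E →ₗ[ℝ] G) {u : H → E} {x : H} {n : WithTop ℕ∞}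
    (hu : ContDiffAt ℝ n u x) : ContDiffAt ℝ n (fun y => f (u y)) x :=
  (LinearMap.toContinuousLinearMap f).contDiff.contDiffAt.comp x hu

theorem fderiv_linear (f : E →ₗ[ℝ] G) {u : H → E} {x : H} (hu : DifferentiableAt ℝ u x) (a : H) :
    fderiv ℝ (fun y => f (u y)) x a = f (fderiv ℝ u x a) := by
  have h := (LinearMap.toContinuousLinearMap f).hasFDerivAt.comp x hu.hasFDerivAt
  exact congrArg (fun L => L a) h.fderiv

theorem contDiffAt_bilinear (f : E →ₗ[ℝ] F →ₗ[ℝ] G) {u : H → E} {v : H → F} {x : H}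
    {n : WithTop ℕ∞} (hu : ContDiffAt ℝ n u x) (hv : ContDiffAt ℝ n v x) :
    ContDiffAt ℝ n (fun y => f (u y) (v y)) x :=
  f.toContinuousBilinearMap.isBoundedBilinearMap.contDiff.contDiffAt.comp x (hu.prodMk hv)

theorem fderiv_bilinear (f : E →ₗ[ℝ] F →ₗ[ℝ] G) {u : H → E} {v : H → F} {x : H}
    (hu : DifferentiableAt ℝ u x) (hv : DifferentiableAt ℝ v x) (a : H) :
    fderiv ℝ (fun y => f (u y) (v y)) x a =
      f (fderiv ℝ u x a) (v x) + f (u x) (fderiv ℝ v x a) := by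
  have h := f.toContinuousBilinearMap.fderiv_of_bilinear hu hv
  refine (congrArg (fun L => L a) h).trans ?_
  rw [add_comm]
  rfl

end Bilinear

/-! ### The derivative of the determinant -/

theorem det_eq_sum (A : Form1 →L[ℝ] Form1) :
    A.det = ∑ σ : Equiv.Perm (Fin 4),
      ((Equiv.Perm.sign σ : ℤ) : ℝ) * ∏ i, A (gammaLow i) (σ i) := by
  rw [ContinuousLinearMap.det, ← LinearMap.det_toMatrix', Matrix.det_apply']
  simp [LinearMap.toMatrix'_apply, gammaLow]

theorem contDiff_det {n : WithTop ℕ∞} :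
    ContDiff ℝ n (fun A : Form1 →L[ℝ] Form1 => A.det) := by
  simp only [det_eq_sum]
  refine ContDiff.sum fun σ _ => contDiff_const.mul (contDiff_prod fun i _ => ?_)
  exact contDiff_apply ℝ ℝ (σ i) |>.comp (contDiff_id.clm_apply contDiff_const)

theorem hasDerivAt_det_one_add_smul (K : Form1 →L[ℝ] Form1) :
    HasDerivAt (fun t : ℝ => (1 + t • K).det) (∑ μ, K (gammaLow μ) μ) 0 := by
  set M := LinearMap.toMatrix' (K : Form1 →ₗ[ℝ] Form1) with hM
  -- What remains of the polynomial `det(1 + tM)` after removing its constant and linear terms: the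
  -- factor of `t²` in the remainder.
  set p := (Matrix.det (1 + (Polynomial.X : Polynomial ℝ) • M.map Polynomial.C)).divX.divX
  have h1 : ∀ t : ℝ, (1 + t • K).det = 1 + M.trace * t + p.eval t * t ^ 2 := by
    intro t
    rw [← Matrix.det_one_add_smul, ContinuousLinearMap.det, ← LinearMap.det_toMatrix']
    congr 1
    simp [hM, ContinuousLinearMap.toLinearMap_one]
  have h2 : ∑ μ, K (gammaLow μ) μ = M.trace := by
    simp [Matrix.trace, hM, LinearMap.toMatrix'_apply, gammaLow]
  rw [h2]
  simp only [h1]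
  have h3 := (((hasDerivAt_id (0 : ℝ)).const_mul M.trace).const_add 1).add
    ((p.hasDerivAt 0).mul ((hasDerivAt_id (0 : ℝ)).pow 2))
  convert! h3 using 1
  simp

/-- Jacobi's formula: factoring `A + tK = A(1 + tA⁻¹K)` reduces it to the derivative at the
identity, which is the trace. -/
theorem fderiv_det {A : Form1 →L[ℝ] Form1} (hA : A.IsInvertible) (K : Form1 →L[ℝ] Form1) :
    fderiv ℝ (fun A : Form1 →L[ℝ] Form1 => A.det) A K =
      A.det * ∑ μ, A.inverse (K (gammaLow μ)) μ := by
  have h1 : HasDerivAt (fun t : ℝ => A + t • K) K 0 := by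
    simpa using ((hasDerivAt_id (0 : ℝ)).smul_const K).const_add A
  have h2 : HasFDerivAt (fun A : Form1 →L[ℝ] Form1 => A.det)
      (fderiv ℝ (fun A : Form1 →L[ℝ] Form1 => A.det) A) (A + (0 : ℝ) • K) := by
    rw [zero_smul, add_zero]
    exact ((contDiff_det (n := 1)).differentiable (by simp) A).hasFDerivAt
  have h3 := h2.comp_hasDerivAt (0 : ℝ) h1
  have h4 : ∀ t : ℝ, (A + t • K).det = A.det * (1 + t • (A.inverse ∘L K)).det := by
    intro t
    have : A + t • K = A ∘L (1 + t • (A.inverse ∘L K)) := by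
      ext v
      simp [hA.self_apply_inverse]
    rw [this]
    exact LinearMap.det_comp _ _
  have h5 := (hasDerivAt_det_one_add_smul (A.inverse ∘L K)).const_mul A.det
  refine h3.unique (h5.congr_of_eventuallyEq (Filter.Eventually.of_forall fun t => ?_))
  exact h4 t

theorem det_ne_zero {A : Form1 →L[ℝ] Form1} (hA : A.IsInvertible) : A.det ≠ 0 := by
  obtain ⟨e, rfl⟩ := hA
  exact e.toLinearEquiv.isUnit_det'.ne_zero

/-! ### The gauge metric and its Levi-Civita connection -/

section Connection

variable {h : Form1 → Form1 →L[ℝ] Form1} {x : Form1}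

theorem dotForm_adj (t : Form1 →L[ℝ] Form1) (a b : Form1) :
    dotForm (adj t a) b = dotForm a (t b) := by
  conv_rhs => rw [← sum_smul_gammaLow b]
  simp only [adj, map_sum, map_smul, LinearMap.sum_apply, LinearMap.smul_apply, dotForm_gammaUp,
    smul_eq_mul, mul_comm]

theorem dotForm_hStar (a b : Form1) : dotForm (hStar h x a) b = dotForm a ((h x).inverse b) :=
  dotForm_adj _ _ _

theorem dotForm_hStar_apply (hi : (h x).IsInvertible) (a b : Form1) :
    dotForm (hStar h x a) (h x b) = dotForm a b := by
  rw [dotForm_hStar, hi.inverse_apply_self]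

theorem fderiv_gaugeMetric (hd : DifferentiableAt ℝ h x) (a b c : Form1) :
    fderiv ℝ (fun y => gaugeMetric h y b c) x a =
      dotForm (fderiv ℝ h x a b) (h x c) + dotForm (h x b) (fderiv ℝ h x a c) := by
  have h1 : ∀ d, DifferentiableAt ℝ (fun y => h y d) x := fun d =>
    hd.clm_apply (differentiableAt_const d)
  have h2 : ∀ d, fderiv ℝ (fun y => h y d) x a = fderiv ℝ h x a d := fun d => by
    rw [fderiv_clm_apply hd (differentiableAt_const d)]
    simp
  simp only [gaugeMetric]
  rw [fderiv_bilinear dotForm (h1 b) (h1 c), h2, h2]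

/-- The derivative `a·∂ g(b, c)` as a trilinear function of `a`, `b`, `c`: here, a bilinear
function of `a` and `c`. -/
def metricDeriv (h : Form1 → Form1 →L[ℝ] Form1) (x b : Form1) : Form1 →ₗ[ℝ] Form1 →ₗ[ℝ] ℝ :=
  LinearMap.mk₂ ℝ
    (fun a c => dotForm (fderiv ℝ h x a b) (h x c) + dotForm (h x b) (fderiv ℝ h x a c))
    (fun a a' c => by simp; ring) (fun r a c => by simp; ring)
    (fun a c c' => by simp; ring) (fun r a c => by simp; ring)

theorem metricDeriv_apply (a b c : Form1) :
    metricDeriv h x b a c =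
      dotForm (fderiv ℝ h x a b) (h x c) + dotForm (h x b) (fderiv ℝ h x a c) := rfl

theorem metricDeriv_comm (a b c : Form1) : metricDeriv h x b a c = metricDeriv h x c a b := by
  rw [metricDeriv_apply, metricDeriv_apply, add_comm, dotForm_comm, dotForm_comm (h x c)]

theorem christoffel_eq (hd : DifferentiableAt ℝ h x) (a b : Form1) :
    christoffel h x a b = (1 / 2 : ℝ) • ∑ μ,
      (metricDeriv h x b a (gammaLow μ) + metricDeriv h x a b (gammaLow μ)
        - metricDeriv h x a (gammaLow μ) b) • (h x).inverse (hStar h x (gammaUp μ)) := by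
  simp only [christoffel, fderiv_gaugeMetric hd, metricDeriv_apply]

/-- The Koszul formula: pairing through `g` undoes the expansion in the `g`-reciprocal basis. -/
theorem dotForm_apply_christoffel (hd : DifferentiableAt ℝ h x) (hi : (h x).IsInvertible)
    (a b c : Form1) :
    dotForm (h x (christoffel h x a b)) (h x c) =
      (1 / 2 : ℝ) * (metricDeriv h x b a c + metricDeriv h x a b c - metricDeriv h x a c b) := by
  rw [christoffel_eq hd]
  conv_rhs => rw [← sum_smul_gammaLow c]
  simp only [map_smul, map_sum, LinearMap.sum_apply, LinearMap.smul_apply, hi.self_apply_inverse,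
    dotForm_hStar_apply hi, dotForm_gammaUp, smul_eq_mul, ← Finset.sum_add_distrib,
    ← Finset.sum_sub_distrib]
  congr 1
  refine Finset.sum_congr rfl fun μ _ => ?_
  ring

theorem differentiableAt_inverse_apply (hd : DifferentiableAt ℝ h x) (hi : (h x).IsInvertible)
    (v : Form1) : DifferentiableAt ℝ (fun y => (h y).inverse v) x := by
  have h1 : ContDiffAt ℝ 1
      (ContinuousLinearMap.inverse : (Form1 →L[ℝ] Form1) → Form1 →L[ℝ] Form1) (h x) :=
    hi.contDiffAt_map_inverse
  have h2 : DifferentiableAt ℝ (fun y => ((h y).inverse : Form1 →L[ℝ] Form1)) x :=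
    (h1.differentiableAt (by simp)).comp x hd
  exact h2.clm_apply (differentiableAt_const v)

/-- Differentiate `h(h⁻¹(v)) = v`, which holds on a neighbourhood. -/
theorem apply_fderiv_inverse_apply (hd : DifferentiableAt ℝ h x)
    (hi : ∀ᶠ y in nhds x, (h y).IsInvertible) (a v : Form1) :
    h x (fderiv ℝ (fun y => (h y).inverse v) x a) = - fderiv ℝ h x a ((h x).inverse v) := by
  have h1 : (fun y => h y ((h y).inverse v)) =ᶠ[nhds x] fun _ => v :=
    hi.mono fun y hy => hy.self_apply_inverse v
  have h2 := h1.fderiv_eq (𝕜 := ℝ)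
  rw [fderiv_clm_apply hd (differentiableAt_inverse_apply hd hi.self_of_nhds v)] at h2
  have h3 := congrArg (fun L => L a) h2
  simp at h3
  exact eq_neg_of_add_eq_zero_left h3

theorem gaugeDerivForm1_const (hd : DifferentiableAt ℝ h x)
    (hi : ∀ᶠ y in nhds x, (h y).IsInvertible) (a v : Form1) :
    gaugeDerivForm1 h a (fun _ => v) x =
      h x (christoffel h x a ((h x).inverse v)) - fderiv ℝ h x a ((h x).inverse v) := by
  rw [gaugeDerivForm1, leviCivita, map_add, apply_fderiv_inverse_apply hd hi]
  abel

/-- Metric compatibility: `h` is an isometry from `g` to the Minkowski product, so `𝒟_a` preserves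
the latter, and the products of constant 1-forms have zero derivative. With `v = h(b)` and `w =
h(c)`, the Koszul formulas for the two sides add up to `a·∂ g(b, c)`. -/
theorem dotForm_gaugeDerivForm1_const (hd : DifferentiableAt ℝ h x)
    (hi : ∀ᶠ y in nhds x, (h y).IsInvertible) (a v w : Form1) :
    dotForm (gaugeDerivForm1 h a (fun _ => v) x) w =
      - dotForm v (gaugeDerivForm1 h a (fun _ => w) x) := by
  have hx := hi.self_of_nhds
  obtain ⟨b, rfl⟩ := hx.surjective v
  obtain ⟨c, rfl⟩ := hx.surjective w
  rw [gaugeDerivForm1_const hd hi, gaugeDerivForm1_const hd hi, hx.inverse_apply_self,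
    hx.inverse_apply_self, map_sub, map_sub, LinearMap.sub_apply,
    dotForm_apply_christoffel hd hx, dotForm_comm (h x b) (h x _), dotForm_apply_christoffel hd hx,
    metricDeriv_comm b a c, metricDeriv_comm c a b, metricDeriv_comm c b a]
  have h1 := metricDeriv_apply (h := h) (x := x) a b c
  rw [metricDeriv_comm] at h1
  have h2 := metricDeriv_comm (h := h) (x := x) a b c
  have h3 := metricDeriv_comm (h := h) (x := x) b a c
  linarith

/-- The linear extension of `γ_ν ↦ 𝒟_a γ_ν`. -/
def connection (h : Form1 → Form1 →L[ℝ] Form1) (x a : Form1) : Form1 →ₗ[ℝ] Form1 :=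
  ∑ ν, (LinearMap.proj ν : Form1 →ₗ[ℝ] ℝ).smulRight (gaugeDerivForm1 h a (fun _ => gammaLow ν) x)

theorem connection_apply (a v : Form1) :
    connection h x a v = ∑ ν, v ν • gaugeDerivForm1 h a (fun _ => gammaLow ν) x := by
  simp [connection, LinearMap.sum_apply]

theorem connection_gammaLow (a : Form1) (ν : Fin 4) :
    connection h x a (gammaLow ν) = gaugeDerivForm1 h a (fun _ => gammaLow ν) x := by
  rw [connection_apply, Finset.sum_eq_single ν]
  · simp [gammaLow]
  · intro μ _ hμ
    simp [gammaLow, hμ]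
  · simp

theorem dotForm_connection (hd : DifferentiableAt ℝ h x)
    (hi : ∀ᶠ y in nhds x, (h y).IsInvertible) (a v w : Form1) :
    dotForm (connection h x a v) w = - dotForm v (connection h x a w) := by
  rw [← sum_smul_gammaLow v, ← sum_smul_gammaLow w]
  simp only [map_sum, map_smul, LinearMap.sum_apply, LinearMap.smul_apply, connection_gammaLow,
    dotForm_gaugeDerivForm1_const hd hi, Finset.sum_neg_distrib, smul_neg]

/-! ### The divergence of the frame -/

/-- The vectors `h⁻¹(h^⋆(γ^μ))` have the inverse metric `g^{μν}` as their matrix of components, and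
this matrix is symmetric. -/
theorem sum_bilin_swap (f : Form1 →ₗ[ℝ] Form1 →ₗ[ℝ] ℝ) :
    ∑ μ, f (gammaLow μ) ((h x).inverse (hStar h x (gammaUp μ))) =
      ∑ μ, f ((h x).inverse (hStar h x (gammaUp μ))) (gammaLow μ) := by
  have key : ∀ μ ν, (h x).inverse (hStar h x (gammaUp μ)) ν =
      (h x).inverse (hStar h x (gammaUp ν)) μ := by
    intro μ ν
    refine (dotForm_gammaUp ν _).symm.trans (Eq.trans ?_ (dotForm_gammaUp μ _))
    rw [← dotForm_hStar, ← dotForm_hStar, dotForm_comm]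
  have expand : ∀ μ, (h x).inverse (hStar h x (gammaUp μ)) =
      ∑ ν, (h x).inverse (hStar h x (gammaUp μ)) ν • gammaLow ν := fun μ =>
    (sum_smul_gammaLow _).symm
  calc _ = ∑ μ, ∑ ν, (h x).inverse (hStar h x (gammaUp μ)) ν * f (gammaLow μ) (gammaLow ν) := by
        refine Finset.sum_congr rfl fun μ _ => ?_
        conv_lhs => rw [expand μ]
        simp only [map_sum, map_smul, smul_eq_mul]
    _ = ∑ ν, ∑ μ, (h x).inverse (hStar h x (gammaUp ν)) μ * f (gammaLow μ) (gammaLow ν) := by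
        rw [Finset.sum_comm]
        simp only [key]
    _ = _ := by
        refine Finset.sum_congr rfl fun μ _ => ?_
        conv_rhs => rw [expand μ]
        simp only [map_sum, map_smul, smul_eq_mul, LinearMap.sum_apply, LinearMap.smul_apply]

/-- This is `Γ^μ_{μb} = b·∂ log |det h|`. In the traced Koszul formula the first and third terms
cancel by symmetry of the inverse metric. In the second, the two halves of the product rule are
equal for the same reason, which absorbs the factor 1/2. -/
theorem sum_christoffel (hd : DifferentiableAt ℝ h x) (hi : (h x).IsInvertible) (b : Form1) :
    ∑ μ, christoffel h x (gammaLow μ) b μ = ∑ μ, (h x).inverse (fderiv ℝ h x b (gammaLow μ)) μ := by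
  have h1 : ∀ μ, christoffel h x (gammaLow μ) b μ =
      (1 / 2 : ℝ) * (metricDeriv h x b (gammaLow μ) ((h x).inverse (hStar h x (gammaUp μ)))
        + metricDeriv h x (gammaLow μ) b ((h x).inverse (hStar h x (gammaUp μ)))
        - metricDeriv h x (gammaLow μ) ((h x).inverse (hStar h x (gammaUp μ))) b) := by
    intro μ
    rw [← dotForm_apply_christoffel hd hi, hi.self_apply_inverse, dotForm_comm,
      dotForm_hStar_apply hi, dotForm_gammaUp]
  have h2 : ∀ μ, (h x).inverse (fderiv ℝ h x b (gammaLow μ)) μ =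
      dotForm (fderiv ℝ h x b (gammaLow μ))
        (h x ((h x).inverse (hStar h x (gammaUp μ)))) := by
    intro μ
    rw [hi.self_apply_inverse, dotForm_comm, dotForm_hStar, dotForm_gammaUp]
  have h3 := sum_bilin_swap (h := h) (x := x) (metricDeriv h x b)
  have h4 := sum_bilin_swap (h := h) (x := x) (dotForm.compl₁₂
    (fderiv ℝ h x b : Form1 →ₗ[ℝ] Form1) (h x : Form1 →ₗ[ℝ] Form1))
  simp only [LinearMap.compl₁₂_apply, ContinuousLinearMap.coe_coe] at h4
  have h5 : ∀ μ, dotForm (fderiv ℝ h x b ((h x).inverse (hStar h x (gammaUp μ))))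
      (h x (gammaLow μ)) = dotForm (h x (gammaLow μ))
        (fderiv ℝ h x b ((h x).inverse (hStar h x (gammaUp μ)))) := fun μ => dotForm_comm _ _
  simp only [h5] at h4
  simp only [h1, h2, ← Finset.mul_sum, Finset.sum_add_distrib, Finset.sum_sub_distrib, h3]
  simp only [metricDeriv_comm (h := h) (x := x) _ b (gammaLow _)]
  simp only [metricDeriv_apply b, Finset.sum_add_distrib, ← h4]
  ring

/-! ### Smoothness of the inverse, of `h^⋆` and of the determinant. -/

theorem contDiffAt_inverse {n : WithTop ℕ∞} (hd : ContDiffAt ℝ n h x) (hi : (h x).IsInvertible) :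
    ContDiffAt ℝ n (fun y => (h y).inverse) x :=
  hi.contDiffAt_map_inverse.comp x hd

theorem contDiffAt_hStar {n : WithTop ℕ∞} (hd : ContDiffAt ℝ n h x) (hi : (h x).IsInvertible)
    (a : Form1) : ContDiffAt ℝ n (fun y => hStar h y a) x := by
  simp only [hStar, adj]
  refine ContDiffAt.sum fun μ _ => ?_
  have h1 := contDiffAt_linear (dotForm a)
    ((contDiffAt_inverse hd hi).clm_apply (contDiffAt_const (c := gammaLow μ)))
  exact h1.smul contDiffAt_const

theorem contDiffAt_det {n : WithTop ℕ∞} (hd : ContDiffAt ℝ n h x) :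
    ContDiffAt ℝ n (fun y => (h y).det) x :=
  contDiff_det.contDiffAt.comp x hd

/-- The frame `h^⋆(γ^μ)`, weighted by `det h`, has vanishing covariant divergence. -/
theorem sum_fderiv_det_smul_hStar (hd : ContDiffAt ℝ 1 h x)
    (hi : ∀ᶠ y in nhds x, (h y).IsInvertible) :
    ∑ μ, (fderiv ℝ (fun y => (h y).det • hStar h y (gammaUp μ)) x (gammaLow μ)
      + (h x).det • connection h x (gammaLow μ) (hStar h x (gammaUp μ))) = 0 := by
  have hx := hi.self_of_nhds
  have hd' : DifferentiableAt ℝ h x := hd.differentiableAt (by simp)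
  have hdet : DifferentiableAt ℝ (fun y => (h y).det) x :=
    (contDiffAt_det hd).differentiableAt (by simp)
  have hfdet : ∀ b, fderiv ℝ (fun y => (h y).det) x b =
      (h x).det * ∑ μ, (h x).inverse (fderiv ℝ h x b (gammaLow μ)) μ := by
    intro b
    have := ((contDiff_det (n := 1)).differentiable (by simp) (h x)).hasFDerivAt.comp x
      hd'.hasFDerivAt
    rw [← fderiv_det hx]
    exact congrArg (fun L => L b) this.fderiv
  have hval : ∀ {c : Form1}, (∀ v, c v = 0) → c = 0 := fun hc => funext hc
  refine hval fun ν => ?_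
  refine (dotForm_gammaUp ν _).symm.trans ?_
  rw [dotForm_comm, gammaUp, map_smul]
  refine smul_eq_zero_of_right _ ?_
  -- Pairing with `γ_ν` turns the components of `h^⋆(γ^μ)` into those of `h⁻¹(γ_ν)`. Moving the
  -- connection onto `γ_ν` then produces minus the derivative of `h⁻¹(γ_ν)`, which cancels the one
  -- from the product rule, and minus `Γ(γ_μ, b)^μ`, which cancels the derivative of the
  -- determinant.
  set b := (h x).inverse (gammaLow ν) with hb
  have h1 : ∀ μ, dotForm (fderiv ℝ (fun y => (h y).det • hStar h y (gammaUp μ)) x (gammaLow μ))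
      (gammaLow ν) = fderiv ℝ (fun y => (h y).det) x (gammaLow μ) * b μ
        + (h x).det * (fderiv ℝ (fun y => (h y).inverse (gammaLow ν)) x (gammaLow μ)) μ := by
    intro μ
    have hs : DifferentiableAt ℝ (fun y => hStar h y (gammaUp μ)) x :=
      (contDiffAt_hStar hd hx _).differentiableAt (by simp)
    have e1 := fderiv_linear (dotForm (gammaLow ν)) (hdet.fun_smul hs) (gammaLow μ)
    rw [dotForm_comm]
    refine e1.symm.trans ?_
    have e2 : (fun y => dotForm (gammaLow ν) ((h y).det • hStar h y (gammaUp μ))) =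
        fun y => (h y).det * (LinearMap.proj μ : Form1 →ₗ[ℝ] ℝ) ((h y).inverse (gammaLow ν)) := by
      funext y
      rw [map_smul, dotForm_comm, dotForm_hStar, dotForm_gammaUp]
      rfl
    have hinv := differentiableAt_inverse_apply hd' hx (gammaLow ν)
    have hp := (contDiffAt_linear (n := 1) (LinearMap.proj μ : Form1 →ₗ[ℝ] ℝ)
      ((contDiffAt_inverse hd hx).clm_apply (contDiffAt_const (c := gammaLow ν)))).differentiableAt
        (by simp)
    rw [e2]
    refine (fderiv_bilinear (LinearMap.mul ℝ ℝ) hdet hp _).trans ?_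
    rw [fderiv_linear _ hinv]
    rfl
  have h2 : ∀ μ, dotForm (connection h x (gammaLow μ) (hStar h x (gammaUp μ))) (gammaLow ν) =
      - ((fderiv ℝ (fun y => (h y).inverse (gammaLow ν)) x (gammaLow μ)) μ
        + christoffel h x (gammaLow μ) b μ) := by
    intro μ
    rw [dotForm_connection hd' hi, connection_gammaLow, dotForm_hStar, dotForm_gammaUp,
      gaugeDerivForm1, hx.inverse_apply_self, leviCivita]
    rfl
  have h3 : ∑ μ, fderiv ℝ (fun y => (h y).det) x (gammaLow μ) * b μ =
      (h x).det * ∑ μ, christoffel h x (gammaLow μ) b μ := by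
    rw [sum_christoffel hd' hx, ← hfdet]
    conv_rhs => rw [← sum_smul_gammaLow b]
    simp only [map_sum, map_smul, smul_eq_mul, mul_comm]
  rw [map_sum, LinearMap.sum_apply]
  simp only [map_add, map_smul, LinearMap.add_apply, LinearMap.smul_apply, h1, h2, smul_eq_mul,
    mul_neg, mul_add, Finset.sum_add_distrib, Finset.sum_neg_distrib, ← Finset.mul_sum, h3]
  ring

end Connection

/-! ### The action of the connection on multiforms -/

/-- The commutator product as a bilinear map. -/
def commutatorL : Multiform →ₗ[ℝ] Multiform →ₗ[ℝ] Multiform :=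
  (1 / 2 : ℝ) • (LinearMap.mul ℝ Multiform - (LinearMap.mul ℝ Multiform).flip)

theorem commutatorL_apply (X Y : Multiform) : commutatorL X Y = commutator X Y := rfl

/-- A bilinear product of 1-forms and multiforms for which all commutator products with simple
bivectors are derivations. -/
def IsRotationInvariant (m : Form1 →ₗ[ℝ] Multiform →ₗ[ℝ] Multiform) : Prop :=
  ∀ (a b v : Form1) (X : Multiform), commutator (wedge (ofForm1 a) (ofForm1 b)) (m v X) =
    m (dotForm b v • a - dotForm a v • b) X
      + m v (commutator (wedge (ofForm1 a) (ofForm1 b)) X)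

theorem isRotationInvariant_wedgeL : IsRotationInvariant wedgeL := by
  intro a b v X
  simp only [commutator_wedge, contractL_wedgeL, map_sub, map_smul, LinearMap.sub_apply,
    LinearMap.smul_apply]
  rw [wedgeL_wedgeL v a, wedgeL_wedgeL v b]
  module

theorem isRotationInvariant_contractL : IsRotationInvariant contractL := by
  intro a b v X
  simp only [commutator_wedge, contractL_wedgeL, map_sub, map_smul, LinearMap.sub_apply,
    LinearMap.smul_apply]
  rw [contractL_contractL v a, contractL_contractL v b, map_neg, map_neg, dotForm_comm v a,
    dotForm_comm v b]
  module

theorem isRotationInvariant_mulL : IsRotationInvariant mulL := by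
  intro a b v X
  rw [mulL_apply, commutator_mul, commutator_wedge_ofForm1]
  rfl

theorem scalarProd_commutator_wedge (a b : Form1) (X Y : Multiform) :
    scalarProd (commutator (wedge (ofForm1 a) (ofForm1 b)) X) Y =
      - scalarProd X (commutator (wedge (ofForm1 a) (ofForm1 b)) Y) := by
  simp only [commutator_wedge, map_sub, LinearMap.sub_apply, scalarProd_wedgeL,
    scalarProd_contractL]
  ring

section Omega

variable {h : Form1 → Form1 →L[ℝ] Form1} {x : Form1}

theorem commutator_Omega (a : Form1) (X : Multiform) :
    commutator (Omega h x a) X = (-(1 / 2) : ℝ) • ∑ ν,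
      commutator (wedge (ofForm1 (gammaUp ν)) (ofForm1 (connection h x a (gammaLow ν)))) X := by
  simp only [← commutatorL_apply, Omega, map_smul, map_sum, LinearMap.smul_apply,
    LinearMap.sum_apply, connection_gammaLow]

theorem scalarProd_commutator_Omega (a : Form1) (X Y : Multiform) :
    scalarProd (commutator (Omega h x a) X) Y = - scalarProd X (commutator (Omega h x a) Y) := by
  simp only [commutator_Omega, map_smul, map_sum, LinearMap.smul_apply, LinearMap.sum_apply,
    scalarProd_commutator_wedge, Finset.sum_neg_distrib, smul_neg]

theorem commutator_Omega_mem_gradeSpace (a : Form1) {S : Finset ℕ} {X : Multiform}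
    (hX : X ∈ gradeSpace S) : commutator (Omega h x a) X ∈ gradeSpace S := by
  rw [commutator_Omega]
  exact Submodule.smul_mem _ _
    (Submodule.sum_mem _ fun ν _ => commutator_wedge_mem_gradeSpace _ _ hX)

/-- `Ω(a)` is a sum of simple bivectors, so rotation invariance applies term by term. The resulting
action on `v` is the connection: by antisymmetry its two sums each contribute half. -/
theorem commutator_Omega_leibniz {m : Form1 →ₗ[ℝ] Multiform →ₗ[ℝ] Multiform}
    (hm : IsRotationInvariant m) (hd : DifferentiableAt ℝ h x)
    (hi : ∀ᶠ y in nhds x, (h y).IsInvertible) (a v : Form1) (X : Multiform) :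
    commutator (Omega h x a) (m v X) =
      m (connection h x a v) X + m v (commutator (Omega h x a) X) := by
  have h1 : connection h x a v = (-(1 / 2) : ℝ) • ∑ ν,
      (dotForm (connection h x a (gammaLow ν)) v • gammaUp ν
        - dotForm (gammaUp ν) v • connection h x a (gammaLow ν)) := by
    have h2 : ∑ ν, dotForm (gammaUp ν) v • connection h x a (gammaLow ν) = connection h x a v := by
      simp only [dotForm_gammaUp]
      conv_rhs => rw [← sum_smul_gammaLow v]
      simp only [map_sum, map_smul]
    have h3 : ∑ ν, dotForm (connection h x a (gammaLow ν)) v • gammaUp ν =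
        - connection h x a v := by
      conv_rhs => rw [← sum_dotForm_smul_gammaUp (connection h x a v)]
      rw [← Finset.sum_neg_distrib]
      refine Finset.sum_congr rfl fun ν _ => ?_
      rw [dotForm_connection hd hi, neg_smul, dotForm_comm]
    rw [Finset.sum_sub_distrib, h2, h3]
    module
  rw [commutator_Omega, commutator_Omega, h1]
  simp only [hm _ _ v X, Finset.sum_add_distrib, smul_add, map_smul, map_sum, LinearMap.smul_apply,
    LinearMap.sum_apply]

/-! ### Smoothness of the connection -/

theorem contDiffAt_gaugeDerivForm1_const (hd : ContDiffAt ℝ ∞ h x)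
    (hi : ∀ᶠ y in nhds x, (h y).IsInvertible) (a v : Form1) :
    ContDiffAt ℝ ∞ (gaugeDerivForm1 h a (fun _ => v)) x := by
  have hx := hi.self_of_nhds
  have hev : gaugeDerivForm1 h a (fun _ => v) =ᶠ[nhds x] fun y =>
      h y ((1 / 2 : ℝ) • ∑ μ,
        (metricDeriv h y ((h y).inverse v) a (gammaLow μ)
          + metricDeriv h y a ((h y).inverse v) (gammaLow μ)
          - metricDeriv h y a (gammaLow μ) ((h y).inverse v))
            • (h y).inverse (hStar h y (gammaUp μ)))
        - fderiv ℝ h y a ((h y).inverse v) := by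
    -- Smoothness at a point gives each finite order on a neighbourhood that may shrink with the
    -- order; order 1 is enough here.
    have h1 : ∀ᶠ y in nhds x, ContDiffAt ℝ 1 h y :=
      (hd.of_le (by simp)).eventually (by simp)
    filter_upwards [h1, hi.eventually_nhds] with y hy hiy
    have hy' := hy.differentiableAt (by simp)
    rw [gaugeDerivForm1_const hy' hiy, christoffel_eq hy']
  refine ContDiffAt.congr_of_eventuallyEq ?_ hev
  have hinv := contDiffAt_inverse hd hx
  have hf : ContDiffAt ℝ ∞ (fderiv ℝ h) x := hd.fderiv_right (by simp)
  have hb : ContDiffAt ℝ ∞ (fun y => (h y).inverse v) x := hinv.clm_apply contDiffAt_const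
  have hK : ∀ {p q r : Form1 → Form1}, ContDiffAt ℝ ∞ p x → ContDiffAt ℝ ∞ q x →
      ContDiffAt ℝ ∞ r x → ContDiffAt ℝ ∞ (fun y => metricDeriv h y (p y) (q y) (r y)) x := by
    intro p q r hp hq hr
    simp only [metricDeriv_apply]
    exact (contDiffAt_bilinear dotForm ((hf.clm_apply hq).clm_apply hp) (hd.clm_apply hr)).add
      (contDiffAt_bilinear dotForm (hd.clm_apply hp) ((hf.clm_apply hq).clm_apply hr))
  refine ContDiffAt.sub (hd.clm_apply (ContDiffAt.const_smul _ (ContDiffAt.sum fun μ _ => ?_)))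
    ((hf.clm_apply contDiffAt_const).clm_apply hb)
  exact (((hK hb contDiffAt_const contDiffAt_const).add
    (hK contDiffAt_const hb contDiffAt_const)).sub
      (hK contDiffAt_const contDiffAt_const hb)).smul
        (hinv.clm_apply (contDiffAt_hStar hd hx _))

theorem contDiffAt_Omega (hd : ContDiffAt ℝ ∞ h x) (hi : ∀ᶠ y in nhds x, (h y).IsInvertible)
    (a : Form1) : ContDiffAt ℝ ∞ (fun y => Omega h y a) x := by
  simp only [Omega, ← wedgeL_apply]
  refine ContDiffAt.const_smul _ (ContDiffAt.sum fun ν _ => ?_)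
  exact contDiffAt_linear (wedgeL (gammaUp ν) ∘ₗ ofForm1)
    (contDiffAt_gaugeDerivForm1_const hd hi a (gammaLow ν))

/-! ### Covariant differential operators -/

/-- The operator `∑ μ, h^⋆(γ^μ) ∗ 𝒟_{γ_μ} X` for a bilinear product `∗` of 1-forms and
multiforms. -/
def covDeriv (m : Form1 →ₗ[ℝ] Multiform →ₗ[ℝ] Multiform) (h : Form1 → Form1 →L[ℝ] Form1)
    (X : Form1 → Multiform) (x : Form1) : Multiform :=
  ∑ μ, m (hStar h x (gammaUp μ)) (gaugeDeriv h (gammaLow μ) X x)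

theorem hDiv_eq_covDeriv (h : Form1 → Form1 →L[ℝ] Form1) : hDiv h = covDeriv contractL h := rfl

theorem hCurl_eq_covDeriv (h : Form1 → Form1 →L[ℝ] Form1) : hCurl h = covDeriv wedgeL h := by
  funext X x
  simp only [hCurl, covDeriv, wedgeL_apply]

theorem hGrad_eq_covDeriv (h : Form1 → Form1 →L[ℝ] Form1) : hGrad h = covDeriv mulL h := rfl

variable {m m' : Form1 →ₗ[ℝ] Multiform →ₗ[ℝ] Multiform}

/-- Finite orders are needed too: the operator is also applied to the derivatives of `ℓ`, which are
only `C¹`. -/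
theorem contDiffAt_covDeriv (m : Form1 →ₗ[ℝ] Multiform →ₗ[ℝ] Multiform)
    (hd : ContDiffAt ℝ ∞ h x) (hi : ∀ᶠ y in nhds x, (h y).IsInvertible)
    {X : Form1 → Multiform} {n k : WithTop ℕ∞} (hX : ContDiffAt ℝ n X x) (hkn : k + 1 ≤ n)
    (hk : k ≤ ∞) : ContDiffAt ℝ k (covDeriv m h X) x := by
  refine ContDiffAt.sum fun μ _ => contDiffAt_bilinear m
    ((contDiffAt_hStar hd hi.self_of_nhds _).of_le hk) ?_
  refine ContDiffAt.add ((hX.fderiv_right hkn).clm_apply contDiffAt_const) ?_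
  exact contDiffAt_bilinear commutatorL ((contDiffAt_Omega hd hi _).of_le hk)
    (hX.of_le (le_self_add.trans hkn))

theorem covDeriv_add_smul {X A : Form1 → Multiform} (hX : DifferentiableAt ℝ X x)
    (hA : DifferentiableAt ℝ A x) (t : ℝ) :
    covDeriv m h (X + t • A) x = covDeriv m h X x + t • covDeriv m h A x := by
  simp only [covDeriv, gaugeDeriv, ← commutatorL_apply]
  rw [fderiv_add hX (hA.const_smul t), fderiv_const_smul hA]
  simp only [_root_.add_apply, _root_.smul_apply, Pi.add_apply,
    Pi.smul_apply, map_add, map_smul, Finset.smul_sum, ← Finset.sum_add_distrib]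
  refine Finset.sum_congr rfl fun μ _ => ?_
  module

theorem covDeriv_smul_const {φ : Form1 → ℝ} (hφ : DifferentiableAt ℝ φ x) (B : Multiform) :
    covDeriv m h (fun y => φ y • B) x = ∑ μ, (fderiv ℝ φ x (gammaLow μ) •
      m (hStar h x (gammaUp μ)) B
        + φ x • m (hStar h x (gammaUp μ)) (commutator (Omega h x (gammaLow μ)) B)) := by
  simp only [covDeriv, gaugeDeriv, ← commutatorL_apply, fderiv_smul_const hφ,
    ContinuousLinearMap.smulRight_apply, map_add, map_smul]

theorem covDeriv_smul_const_mem_gradeSpace {S T : Finset ℕ}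
    (hm : ∀ (a : Form1) {X : Multiform}, X ∈ gradeSpace S → m a X ∈ gradeSpace T)
    {φ : Form1 → ℝ} (hφ : DifferentiableAt ℝ φ x) {B : Multiform} (hB : B ∈ gradeSpace S) :
    covDeriv m h (fun y => φ y • B) x ∈ gradeSpace T := by
  rw [covDeriv_smul_const hφ]
  exact Submodule.sum_mem _ fun μ _ => Submodule.add_mem _ (Submodule.smul_mem _ _ (hm _ hB))
    (Submodule.smul_mem _ _ (hm _ (commutator_Omega_mem_gradeSpace _ hB)))

/-- The current `det h · (B · (h^⋆(γ^μ) ∗ Y))`. -/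
def current (m : Form1 →ₗ[ℝ] Multiform →ₗ[ℝ] Multiform) (h : Form1 → Form1 →L[ℝ] Form1)
    (B : Multiform) (Y : Form1 → Multiform) (μ : Fin 4) (x : Form1) : ℝ :=
  scalarProd B (m ((h x).det • hStar h x (gammaUp μ)) (Y x))

theorem contDiffAt_current (m : Form1 →ₗ[ℝ] Multiform →ₗ[ℝ] Multiform) {n : WithTop ℕ∞}
    (hd : ContDiffAt ℝ n h x) (hi : (h x).IsInvertible) (B : Multiform) {Y : Form1 → Multiform}
    (hY : ContDiffAt ℝ n Y x) (μ : Fin 4) : ContDiffAt ℝ n (current m h B Y μ) x :=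
  contDiffAt_linear (scalarProd B)
    (contDiffAt_bilinear m ((contDiffAt_det hd).smul (contDiffAt_hStar hd hi _)) hY)

/-- The frame lemma trades the derivative of the weighted frame for minus the connection acting on
it. The Leibniz rule for `Ω` then completes the covariant derivative of `Y`, at the price of a
commutator with the whole product. -/
theorem sum_fderiv_current (hm : IsRotationInvariant m) (hd : ContDiffAt ℝ 1 h x)
    (hi : ∀ᶠ y in nhds x, (h y).IsInvertible) (B : Multiform) {Y : Form1 → Multiform}
    (hY : DifferentiableAt ℝ Y x) :
    ∑ μ, fderiv ℝ (current m h B Y μ) x (gammaLow μ) =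
      (h x).det * (scalarProd B (covDeriv m h Y x) - ∑ μ, scalarProd B
        (commutator (Omega h x (gammaLow μ)) (m (hStar h x (gammaUp μ)) (Y x)))) := by
  have hx := hi.self_of_nhds
  have hd' : DifferentiableAt ℝ h x := hd.differentiableAt (by simp)
  have h1 : ∀ μ, fderiv ℝ (current m h B Y μ) x (gammaLow μ) =
      scalarProd B (m (fderiv ℝ (fun y => (h y).det • hStar h y (gammaUp μ)) x (gammaLow μ)) (Y x))
        + (h x).det * scalarProd B (m (hStar h x (gammaUp μ)) (fderiv ℝ Y x (gammaLow μ))) := by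
    intro μ
    have hs : DifferentiableAt ℝ (fun y => (h y).det • hStar h y (gammaUp μ)) x :=
      ((contDiffAt_det hd).smul (contDiffAt_hStar hd hx _)).differentiableAt (by simp)
    have e := fderiv_bilinear (m.compr₂ (scalarProd B)) hs hY (gammaLow μ)
    refine e.trans ?_
    simp only [LinearMap.compr₂_apply, map_smul, LinearMap.smul_apply, smul_eq_mul]
  have h2 := congrArg (fun v => scalarProd B (m v (Y x))) (sum_fderiv_det_smul_hStar hd hi)
  simp only [map_sum, map_add, map_smul, LinearMap.sum_apply, LinearMap.add_apply,
    LinearMap.smul_apply, map_zero, LinearMap.zero_apply, smul_eq_mul] at h2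
  simp only [h1, covDeriv, gaugeDeriv, commutator_Omega_leibniz hm hd' hi, map_add, map_sum,
    Finset.sum_add_distrib, mul_sub, mul_add, Finset.mul_sum] at h2 ⊢
  linarith

/-- The adjoint of a covariant differential operator, up to the divergence of a current. -/
theorem scalarProd_covDeriv_add (hm' : IsRotationInvariant m')
    (hmm' : ∀ a X Y, scalarProd (m a X) Y = scalarProd X (m' a Y))
    (hd : ContDiffAt ℝ 1 h x) (hi : ∀ᶠ y in nhds x, (h y).IsInvertible)
    {φ : Form1 → ℝ} (hφ : DifferentiableAt ℝ φ x) (B : Multiform) {Y : Form1 → Multiform}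
    (hY : DifferentiableAt ℝ Y x) :
    (h x).det * scalarProd (covDeriv m h (fun y => φ y • B) x) (Y x)
      + φ x * ((h x).det * scalarProd B (covDeriv m' h Y x)) =
    ∑ μ, (fderiv ℝ φ x (gammaLow μ) * current m' h B Y μ x
      + φ x * fderiv ℝ (current m' h B Y μ) x (gammaLow μ)) := by
  rw [Finset.sum_add_distrib, ← Finset.mul_sum, sum_fderiv_current hm' hd hi B hY,
    covDeriv_smul_const hφ]
  -- Adjointness and antisymmetry turn the term of `𝒟*(φB)` with `Ω × B` into the commutator term
  -- left over in the divergence of the current.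
  simp only [current, map_sum, map_add, map_smul, LinearMap.sum_apply, LinearMap.add_apply,
    LinearMap.smul_apply, smul_eq_mul, hmm', scalarProd_commutator_Omega, Finset.sum_add_distrib,
    mul_add, mul_sub, mul_neg, Finset.sum_neg_distrib, Finset.mul_sum]
  simp only [mul_left_comm (h x).det]
  ring

end Omega

/-! ### Calculus of variations -/

section Analysis

variable {U K : Set Form1}

theorem integrable_of_support_subset_compact (hK : IsCompact K) {f : Form1 → ℝ}
    (hf : ContinuousOn f K) (hs : Function.support f ⊆ K) : Integrable f :=
  (integrableOn_iff_integrable_of_support_subset hs).1 (hf.integrableOn_compact hK)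

/-- `G` is controlled on `U` only, which suffices because every integrand is supported in the
compact set `tsupport φ`. -/
theorem integral_fderiv_mul_add {φ G : Form1 → ℝ} (hφ : ContDiff ℝ ∞ φ)
    (hc : HasCompactSupport φ) (hφU : tsupport φ ⊆ U) (hG : ∀ x ∈ U, ContDiffAt ℝ 1 G x)
    (v : Form1) :
    Integrable (fun x => fderiv ℝ φ x v * G x + φ x * fderiv ℝ G x v) ∧
      ∫ x, (fderiv ℝ φ x v * G x + φ x * fderiv ℝ G x v) = 0 := by
  have hφ' : Continuous fun x => fderiv ℝ φ x v :=
    (hφ.continuous_fderiv (by simp)).clm_apply continuous_const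
  have hGc : ContinuousOn G (tsupport φ) := fun x hx =>
    (hG x (hφU hx)).continuousAt.continuousWithinAt
  have hGc' : ContinuousOn (fun x => fderiv ℝ G x v) (tsupport φ) := fun x hx =>
    (((hG x (hφU hx)).continuousAt_fderiv (by simp)).clm_apply
      continuousAt_const).continuousWithinAt
  have i1 : Integrable fun x => fderiv ℝ φ x v * G x := by
    refine integrable_of_support_subset_compact hc (hφ'.continuousOn.mul hGc) fun x hx => ?_
    refine support_fderiv_subset ℝ (f := φ) ?_
    intro h0
    simp [h0] at hx
  have i2 : Integrable fun x => φ x * fderiv ℝ G x v := by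
    refine integrable_of_support_subset_compact hc (hφ.continuous.continuousOn.mul hGc')
      fun x hx => subset_tsupport φ ?_
    intro h0
    simp [h0] at hx
  have i3 : Integrable fun x => φ x * G x := by
    refine integrable_of_support_subset_compact hc (hφ.continuous.continuousOn.mul hGc)
      fun x hx => subset_tsupport φ ?_
    intro h0
    simp [h0] at hx
  refine ⟨i1.add i2, ?_⟩
  rw [integral_add i1 i2, integral_mul_fderiv_eq_neg_fderiv_mul_of_integrable i1 i2 i3
    (fun x _ => hφ.differentiable (by simp) x)
    (fun x hx => (hG x (hφU hx)).differentiableAt (by simp))]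
  ring

theorem eq_zero_of_integral_mul_eq_zero (hU : IsOpen U) {f : Form1 → ℝ} (hf : ContinuousOn f U)
    (h : ∀ φ : Form1 → ℝ, ContDiff ℝ ∞ φ → HasCompactSupport φ → tsupport φ ⊆ U →
      ∫ x, φ x * f x = 0) : ∀ x ∈ U, f x = 0 := by
  have h1 := hU.ae_eq_zero_of_integral_contDiff_smul_eq_zero
    (hf.locallyIntegrableOn hU.measurableSet) h
  exact Measure.eqOn_open_of_ae_eq ((ae_restrict_iff' hU.measurableSet).2 h1) hU hf
    continuousOn_const

/-- Differentiation under the integral sign of an action along a compactly supported variation. -/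
theorem hasDerivAt_action {V : Type*} [NormedAddCommGroup V] [NormedSpace ℝ V] (hU : IsOpen U)
    (hK : IsCompact K) (hKU : K ⊆ U) {w : Form1 → ℝ} {p q : Form1 → V} {l : V → ℝ}
    (hw : ContinuousOn w U) (hp : ContinuousOn p U) (hq : ContinuousOn q U)
    (hqK : ∀ x ∈ U, x ∉ K → q x = 0) (hl : ∀ x ∈ U, ContDiffAt ℝ 1 l (p x))
    (hInt : IntegrableOn (fun x => w x * l (p x)) U) :
    HasDerivAt (fun t : ℝ => ∫ x in U, w x * l (p x + t • q x))
      (∫ x in U, w x * fderiv ℝ l (p x) (q x)) 0 := by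
  have hWo : IsOpen {v | ContDiffAt ℝ 1 l v} :=
    isOpen_iff_mem_nhds.2 fun v hv => ContDiffAt.eventually hv (by simp)
  have hΦ : ContinuousOn (fun z : ℝ × Form1 => p z.2 + z.1 • q z.2) (Set.univ ×ˢ U) := by
    have h2 : Set.MapsTo (Prod.snd : ℝ × Form1 → Form1) (Set.univ ×ˢ U) U := fun z hz => hz.2
    exact (hp.comp continuousOn_snd h2).add (continuousOn_fst.smul (hq.comp continuousOn_snd h2))
  -- Compactness of `K` gives one interval of parameters for which the varied arguments over all of
  -- `K` stay among the points where `l` is `C¹`.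
  obtain ⟨u, v, huo, -, hu, hv, huv⟩ := generalized_tube_lemma (isCompact_singleton (x := (0 : ℝ)))
    hK (hΦ.isOpen_inter_preimage (isOpen_univ.prod hU) hWo) (by
      rintro ⟨t, x⟩ ⟨ht, hx⟩
      rw [Set.mem_singleton_iff] at ht
      subst ht
      refine ⟨⟨trivial, hKU hx⟩, ?_⟩
      simpa using hl x (hKU hx))
  obtain ⟨r, hr, hru⟩ := Metric.nhds_basis_closedBall.mem_iff.1
    (huo.mem_nhds (hu (Set.mem_singleton 0)))
  have hW : ∀ t ∈ Metric.closedBall (0 : ℝ) r, ∀ x ∈ K, ContDiffAt ℝ 1 l (p x + t • q x) :=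
    fun t ht x hx => (huv (Set.mk_mem_prod (hru ht) (hv hx))).2
  have hF' : ContinuousOn (fun z : ℝ × Form1 => w z.2 * fderiv ℝ l (p z.2 + z.1 • q z.2) (q z.2))
      (Metric.closedBall 0 r ×ˢ K) := by
    have h2 : Set.MapsTo (Prod.snd : ℝ × Form1 → Form1) (Metric.closedBall 0 r ×ˢ K) U :=
      fun z hz => hKU hz.2
    refine (hw.comp continuousOn_snd h2).mul
      (ContinuousOn.clm_apply ?_ (hq.comp continuousOn_snd h2))
    intro z hz
    refine ContinuousAt.comp_continuousWithinAt (f := fun z : ℝ × Form1 => p z.2 + z.1 • q z.2)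
      ((hW z.1 hz.1 z.2 hz.2).continuousAt_fderiv (by simp)) ?_
    exact (hΦ z ⟨trivial, hKU hz.2⟩).mono fun y hy => ⟨trivial, hKU hy.2⟩
  obtain ⟨C, hC⟩ := ((isCompact_closedBall (0 : ℝ) r).prod hK).exists_bound_of_continuousOn hF'
  have hwK := hw.mono hKU
  have hpK := hp.mono hKU
  have hqK' := hq.mono hKU
  have hΦK : ∀ t : ℝ, ContinuousOn (fun x => p x + t • q x) K := fun t =>
    hpK.add (hqK'.const_smul t)
  have meas_of_support : ∀ {f : Form1 → ℝ}, ContinuousOn f K → (∀ x ∈ U, x ∉ K → f x = 0) →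
      AEStronglyMeasurable f (volume.restrict U) := by
    intro f hf h0
    have h1 : AEStronglyMeasurable (K.indicator f) (volume.restrict U) :=
      ((aestronglyMeasurable_indicator_iff hK.measurableSet).2
        (hf.aestronglyMeasurable hK.measurableSet)).mono_measure Measure.restrict_le_self
    refine h1.congr ?_
    filter_upwards [ae_restrict_mem hU.measurableSet] with x hx
    by_cases hxK : x ∈ K
    · rw [Set.indicator_of_mem hxK]
    · rw [Set.indicator_of_notMem hxK, h0 x hx hxK]
  have key := hasDerivAt_integral_of_dominated_loc_of_deriv_le (μ := volume.restrict U)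
    (F := fun (t : ℝ) x => w x * l (p x + t • q x))
    (F' := fun (t : ℝ) x => w x * fderiv ℝ l (p x + t • q x) (q x)) (x₀ := (0 : ℝ))
    (bound := K.indicator fun _ => C) (Metric.ball_mem_nhds 0 hr) ?_ ?_ ?_ ?_ ?_ ?_
  · simpa using key.2
  · filter_upwards [Metric.closedBall_mem_nhds (0 : ℝ) hr] with t ht
    -- The variation changes the integrand on `K` only, so the difference is measurable by
    -- continuity there; the unvaried integrand is measurable since it is integrable.
    have h1 : AEStronglyMeasurable (fun x => w x * l (p x + t • q x) - w x * l (p x))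
        (volume.restrict U) := by
      refine meas_of_support ((hwK.mul ?_).sub (hwK.mul ?_)) fun x hx hxK => ?_
      · exact fun x hx => ContinuousAt.comp_continuousWithinAt (f := fun x => p x + t • q x)
          (hW t ht x hx).continuousAt (hΦK t x hx)
      · exact fun x hx => ContinuousAt.comp_continuousWithinAt (hl x (hKU hx)).continuousAt
          (hpK x hx)
      · simp [hqK x hx hxK]
    exact (h1.add hInt.aestronglyMeasurable).congr (Filter.Eventually.of_forall fun x => by simp)
  · simpa [IntegrableOn] using hInt
  · refine meas_of_support ?_ fun x hx hxK => by simp [hqK x hx hxK]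
    exact hF'.comp (f := fun x => ((0 : ℝ), x)) (by fun_prop)
      fun x hx => ⟨Metric.mem_closedBall_self hr.le, hx⟩
  · filter_upwards [ae_restrict_mem hU.measurableSet] with x hx t ht
    by_cases hxK : x ∈ K
    · rw [Set.indicator_of_mem hxK]
      exact hC (t, x) ⟨Metric.ball_subset_closedBall ht, hxK⟩
    · simp [Set.indicator_of_notMem hxK, hqK x hx hxK]
  · refine Integrable.mono_measure ?_ Measure.restrict_le_self
    rw [integrable_indicator_iff hK.measurableSet]
    exact continuousOn_const.integrableOn_compact hK
  · filter_upwards [ae_restrict_mem hU.measurableSet] with x hx t ht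
    by_cases hxK : x ∈ K
    · have h1 : HasDerivAt (fun t : ℝ => p x + t • q x) (q x) t := by
        simpa using ((hasDerivAt_id t).smul_const (q x)).const_add (p x)
      have h2 := ((hW t (Metric.ball_subset_closedBall ht) x hxK).differentiableAt
        (by simp)).hasFDerivAt
      exact (h2.comp_hasDerivAt t h1).const_mul (w x)
    · simp only [hqK x hx hxK, smul_zero, add_zero, map_zero, mul_zero]
      exact hasDerivAt_const t _

end Analysis

/-! ### The multiform derivatives of the Lagrangian -/

theorem fderiv_partial_fst {l : Multiform × Multiform → ℝ} {X Y : Multiform}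
    (hl : DifferentiableAt ℝ l (X, Y)) (B : Multiform) :
    fderiv ℝ (fun Z => l (Z, Y)) X B = fderiv ℝ l (X, Y) (B, 0) := by
  have h := hl.hasFDerivAt.comp X (hasFDerivAt_prodMk_left (𝕜 := ℝ) X Y)
  exact congrArg (fun L => L B) h.fderiv

theorem fderiv_partial_snd {l : Multiform × Multiform → ℝ} {X Y : Multiform}
    (hl : DifferentiableAt ℝ l (X, Y)) (B : Multiform) :
    fderiv ℝ (fun Z => l (X, Z)) Y B = fderiv ℝ l (X, Y) (0, B) := by
  have h := hl.hasFDerivAt.comp Y (hasFDerivAt_prodMk_right (𝕜 := ℝ) X Y)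
  exact congrArg (fun L => L B) h.fderiv

section Lagrangian

variable {D : (Form1 → Multiform) → Form1 → Multiform} {l : Multiform × Multiform → ℝ}
  {X : Form1 → Multiform} {x : Form1}

/-- Near `x` the partial gradient has components given by the full derivative of `ℓ` in fixed
directions, so exactly one of the two orders of differentiability is lost. -/
theorem contDiffAt_derivFst (S : Finset ℕ) (hX : ContDiffAt ℝ 1 X x)
    (hDX : ContDiffAt ℝ 1 (D X) x) (hl : ∀ᶠ y in nhds x, ContDiffAt ℝ 2 l (X y, D X y)) :
    ContDiffAt ℝ 1 (derivFst S D l X) x := by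
  change ContDiffAt ℝ 1 (fun y => derivFst S D l X y) x
  simp only [derivFst, multiformDeriv]
  refine ContDiffAt.sum fun I _ => ?_
  split_ifs
  · have hev : (fun y => fderiv ℝ (fun Z => l (Z, D X y)) (X y) (blade I)) =ᶠ[nhds x]
        fun y => fderiv ℝ l (X y, D X y) (blade I, 0) :=
      hl.mono fun y hy => fderiv_partial_fst (hy.differentiableAt (by simp)) _
    have h1 : ContDiffAt ℝ 1 (fderiv ℝ l) (X x, D X x) :=
      hl.self_of_nhds.fderiv_right (by norm_num)
    have h2 : ContDiffAt ℝ 1 (fun y => fderiv ℝ l (X y, D X y) (blade I, 0)) x :=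
      (h1.comp x (f := fun y => (X y, D X y)) (hX.prodMk hDX)).clm_apply contDiffAt_const
    exact (h2.congr_of_eventuallyEq hev).smul contDiffAt_const
  · exact contDiffAt_const

theorem contDiffAt_derivSnd (T : Finset ℕ) (hX : ContDiffAt ℝ 1 X x)
    (hDX : ContDiffAt ℝ 1 (D X) x) (hl : ∀ᶠ y in nhds x, ContDiffAt ℝ 2 l (X y, D X y)) :
    ContDiffAt ℝ 1 (derivSnd T D l X) x := by
  change ContDiffAt ℝ 1 (fun y => derivSnd T D l X y) x
  simp only [derivSnd, multiformDeriv]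
  refine ContDiffAt.sum fun I _ => ?_
  split_ifs
  · have hev : (fun y => fderiv ℝ (fun Z => l (X y, Z)) (D X y) (blade I)) =ᶠ[nhds x]
        fun y => fderiv ℝ l (X y, D X y) (0, blade I) :=
      hl.mono fun y hy => fderiv_partial_snd (hy.differentiableAt (by simp)) _
    have h1 : ContDiffAt ℝ 1 (fderiv ℝ l) (X x, D X x) :=
      hl.self_of_nhds.fderiv_right (by norm_num)
    have h2 : ContDiffAt ℝ 1 (fun y => fderiv ℝ l (X y, D X y) (0, blade I)) x :=
      (h1.comp x (f := fun y => (X y, D X y)) (hX.prodMk hDX)).clm_apply contDiffAt_const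
    exact (h2.congr_of_eventuallyEq hev).smul contDiffAt_const
  · exact contDiffAt_const

/-- The grade conditions are essential: the multiform derivatives see only directions in `Λ^S` and
`Λ^T`. -/
theorem fderiv_lagrangian {S T : Finset ℕ} (hl : DifferentiableAt ℝ l (X x, D X x))
    {A B : Multiform} (hA : A ∈ gradeSpace S) (hB : B ∈ gradeSpace T) :
    fderiv ℝ l (X x, D X x) (A, B) =
      scalarProd A (derivFst S D l X x) + scalarProd B (derivSnd T D l X x) := by
  rw [derivFst, derivSnd, scalarProd_multiformDeriv _ _ hA, scalarProd_multiformDeriv _ _ hB,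
    fderiv_partial_fst hl, fderiv_partial_snd hl, ← map_add, Prod.mk_add_mk, add_zero, zero_add]

end Lagrangian

/-! ### The Euler–Lagrange equations -/

section EulerLagrange

variable {U : Set Form1} {h : Form1 → Form1 →L[ℝ] Form1} {S T : Finset ℕ}
  {X : Form1 → Multiform} {l : Multiform × Multiform → ℝ}
  {m m' : Form1 →ₗ[ℝ] Multiform →ₗ[ℝ] Multiform}

/-- The weak form of the Euler–Lagrange equation, for variations `φ • B` with constant `B`. -/
theorem integral_mul_eulerLagrange_eq_zero (hU : IsOpen U) (hh : ContDiffOn ℝ ∞ h U)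
    (hinv : ∀ x ∈ U, (h x).IsInvertible) (hX : ContDiffOn ℝ ∞ X U)
    (hm : ∀ (a : Form1) {X : Multiform}, X ∈ gradeSpace S → m a X ∈ gradeSpace T)
    (hm' : IsRotationInvariant m')
    (hmm' : ∀ a X Y, scalarProd (m a X) Y = scalarProd X (m' a Y))
    (hl : ∀ x ∈ U, ContDiffAt ℝ 2 l (X x, covDeriv m h X x))
    (hstat : IsStationary S U h (covDeriv m h) l X) {B : Multiform} (hB : B ∈ gradeSpace S)
    {φ : Form1 → ℝ} (hφ : ContDiff ℝ ∞ φ) (hc : HasCompactSupport φ) (hφU : tsupport φ ⊆ U) :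
    ∫ x, φ x * ((h x).det * scalarProd B (derivFst S (covDeriv m h) l X x
      - covDeriv m' h (derivSnd T (covDeriv m h) l X) x)) = 0 := by
  set D := covDeriv m h with hD
  set Y := derivSnd T D l X with hYdef
  set A : Form1 → Multiform := fun y => φ y • B with hAdef
  have hd : ∀ x ∈ U, ContDiffAt ℝ ∞ h x := fun x hx => hh.contDiffAt (hU.mem_nhds hx)
  have hi : ∀ x ∈ U, ∀ᶠ y in nhds x, (h y).IsInvertible := fun x hx =>
    Filter.mem_of_superset (hU.mem_nhds hx) hinv
  have hX' : ∀ x ∈ U, ContDiffAt ℝ ∞ X x := fun x hx => hX.contDiffAt (hU.mem_nhds hx)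
  have hl' : ∀ x ∈ U, ∀ᶠ y in nhds x, ContDiffAt ℝ 2 l (X y, D X y) := fun x hx =>
    Filter.mem_of_superset (hU.mem_nhds hx) hl
  have hDX : ∀ x ∈ U, ContDiffAt ℝ ∞ (D X) x := fun x hx =>
    contDiffAt_covDeriv m (hd x hx) (hi x hx) (hX' x hx) (by simp) le_rfl
  have hA : ContDiff ℝ ∞ A := hφ.smul contDiff_const
  have hDA : ∀ x ∈ U, ContDiffAt ℝ ∞ (D A) x := fun x hx =>
    contDiffAt_covDeriv m (hd x hx) (hi x hx) hA.contDiffAt (by simp) le_rfl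
  have hY : ∀ x ∈ U, ContDiffAt ℝ 1 Y x := fun x hx =>
    contDiffAt_derivSnd T ((hX' x hx).of_le (by simp)) ((hDX x hx).of_le (by simp)) (hl' x hx)
  have hφd : ∀ x, DifferentiableAt ℝ φ x := fun x => hφ.differentiable (by simp) x
  have hAs : tsupport A ⊆ tsupport φ := closure_mono (Function.support_smul_subset_left φ _)
  -- the first variation of the action
  have hq : ∀ x ∈ U, x ∉ tsupport φ → (A x, D A x) = 0 := by
    intro x _ hx
    have h0 : φ x = 0 := image_eq_zero_of_notMem_tsupport hx
    have h1 : fderiv ℝ φ x = 0 := by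
      by_contra hne
      exact hx (support_fderiv_subset ℝ hne)
    have h2 : D A x = 0 := by
      rw [hD, hAdef, covDeriv_smul_const (hφd x), h0, h1]
      simp
    rw [h2, hAdef]
    simp [h0]
  have hvar := hasDerivAt_action hU hc hφU
    (w := fun x => (h x).det) (p := fun x => (X x, D X x)) (q := fun x => (A x, D A x)) (l := l)
    (fun x hx => (contDiffAt_det (hd x hx)).continuousAt.continuousWithinAt)
    (fun x hx => ((hX' x hx).prodMk (hDX x hx)).continuousAt.continuousWithinAt)
    (fun x hx => (hA.contDiffAt.prodMk (hDA x hx)).continuousAt.continuousWithinAt)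
    hq (fun x hx => (hl x hx).of_le (by norm_num)) hstat.1
  have hact : (fun t : ℝ => action U h D l (X + t • A)) =
      fun t => ∫ x in U, (h x).det * l ((X x, D X x) + t • (A x, D A x)) := by
    funext t
    refine setIntegral_congr_fun hU.measurableSet fun x hx => ?_
    simp only [lagrangian]
    rw [hD, covDeriv_add_smul ((hX' x hx).differentiableAt (by simp))
      (hA.differentiable (by simp) x)]
    rfl
  have hzero := hstat.2 A hA
    (fun x => gradePart_eq_self_iff.2 (Submodule.smul_mem _ _ hB)) (hc.mono' (subset_closure.trans
      hAs)) (hAs.trans hφU)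
  rw [hact] at hzero
  have h1 := hvar.unique hzero
  -- integration by parts
  have hG : ∀ μ, ∀ x ∈ U, ContDiffAt ℝ 1 (current m' h B Y μ) x := fun μ x hx =>
    contDiffAt_current m' ((hd x hx).of_le (by simp)) (hinv x hx) B (hY x hx) μ
  have hibp := fun μ => integral_fderiv_mul_add hφ hc hφU (hG μ) (gammaLow μ)
  have h2 : ∫ x, ∑ μ, (fderiv ℝ φ x (gammaLow μ) * current m' h B Y μ x
      + φ x * fderiv ℝ (current m' h B Y μ) x (gammaLow μ)) = 0 := by
    rw [integral_finsetSum _ fun μ _ => (hibp μ).1]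
    exact Finset.sum_eq_zero fun μ _ => (hibp μ).2
  have hout : ∀ x, x ∉ U → φ x = 0 ∧ fderiv ℝ φ x = 0 := by
    intro x hx
    refine ⟨image_eq_zero_of_notMem_tsupport fun h => hx (hφU h), ?_⟩
    by_contra hne
    exact hx (hφU (support_fderiv_subset ℝ hne))
  -- `φ` and its derivative vanish off `U`, so integrals over the whole space and over `U` agree,
  -- whatever the currents are outside `U`.
  rw [← setIntegral_eq_integral_of_forall_compl_eq_zero (s := U)
    (fun x hx => by simp [(hout x hx).1, (hout x hx).2])] at h2
  rw [← setIntegral_eq_integral_of_forall_compl_eq_zero (s := U)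
    (fun x hx => by simp [(hout x hx).1])]
  have hi2 : IntegrableOn (fun x => ∑ μ, (fderiv ℝ φ x (gammaLow μ) * current m' h B Y μ x
      + φ x * fderiv ℝ (current m' h B Y μ) x (gammaLow μ))) U :=
    (integrable_finsetSum _ fun μ _ => (hibp μ).1).integrableOn
  have hi1 : IntegrableOn (fun x => φ x * ((h x).det * scalarProd B (derivFst S D l X x
      - covDeriv m' h Y x))) U := by
    refine (integrable_of_support_subset_compact hc ?_ fun x hx => ?_).integrableOn
    · intro x hx
      have hxU := hφU hx
      have c1 := contDiffAt_derivFst S ((hX' x hxU).of_le (by simp : (1 : WithTop ℕ∞) ≤ ∞))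
        ((hDX x hxU).of_le (by simp)) (hl' x hxU)
      have c2 := contDiffAt_covDeriv m' (hd x hxU) (hi x hxU) (hY x hxU) (k := 0) (by simp)
        (by simp)
      exact (hφ.continuous.continuousAt.mul ((contDiffAt_det (hd x hxU)).continuousAt.mul
        (contDiffAt_linear (scalarProd B)
          ((c1.of_le (by simp)).sub c2)).continuousAt)).continuousWithinAt
    · refine subset_tsupport φ fun h0 => ?_
      simp [h0] at hx
  -- The first variation is, pointwise on `U`, the tested Euler–Lagrange expression plus the
  -- divergence of the `φ`-weighted currents.
  have h3 : ∫ x in U, (h x).det * fderiv ℝ l (X x, D X x) (A x, D A x) =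
      ∫ x in U, (φ x * ((h x).det * scalarProd B (derivFst S D l X x - covDeriv m' h Y x))
        + ∑ μ, (fderiv ℝ φ x (gammaLow μ) * current m' h B Y μ x
          + φ x * fderiv ℝ (current m' h B Y μ) x (gammaLow μ))) := by
    refine setIntegral_congr_fun hU.measurableSet fun x hx => ?_
    rw [fderiv_lagrangian ((hl x hx).differentiableAt (by simp)) (Submodule.smul_mem _ (φ x) hB)
      (covDeriv_smul_const_mem_gradeSpace hm (hφd x) hB),
      ← scalarProd_covDeriv_add hm' hmm' ((hd x hx).of_le (by simp)) (hi x hx) (hφd x) B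
        ((hY x hx).differentiableAt (by simp))]
    simp only [map_smul, map_sub, LinearMap.smul_apply, smul_eq_mul]
    ring
  rw [h3, integral_add hi1 hi2, h2, add_zero] at h1
  exact h1

/-- Testing against the blades with grades in `S` isolates the components, up to the nonzero factors
`det h` and `∏ η`. -/
theorem gradePart_eulerLagrange_eq_zero (hU : IsOpen U) (hh : ContDiffOn ℝ ∞ h U)
    (hinv : ∀ x ∈ U, (h x).IsInvertible) (hX : ContDiffOn ℝ ∞ X U)
    (hm : ∀ (a : Form1) {X : Multiform}, X ∈ gradeSpace S → m a X ∈ gradeSpace T)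
    (hm' : IsRotationInvariant m')
    (hmm' : ∀ a X Y, scalarProd (m a X) Y = scalarProd X (m' a Y))
    (hl : ∀ x ∈ U, ContDiffAt ℝ 2 l (X x, covDeriv m h X x))
    (hstat : IsStationary S U h (covDeriv m h) l X) {x : Form1} (hx : x ∈ U) :
    gradePart S (derivFst S (covDeriv m h) l X x
      - covDeriv m' h (derivSnd T (covDeriv m h) l X) x) = 0 := by
  have hd : ∀ x ∈ U, ContDiffAt ℝ ∞ h x := fun x hx => hh.contDiffAt (hU.mem_nhds hx)
  have hi : ∀ x ∈ U, ∀ᶠ y in nhds x, (h y).IsInvertible := fun x hx =>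
    Filter.mem_of_superset (hU.mem_nhds hx) hinv
  have hX' : ∀ x ∈ U, ContDiffAt ℝ ∞ X x := fun x hx => hX.contDiffAt (hU.mem_nhds hx)
  have hl' : ∀ x ∈ U, ∀ᶠ y in nhds x, ContDiffAt ℝ 2 l (X y, covDeriv m h X y) := fun x hx =>
    Filter.mem_of_superset (hU.mem_nhds hx) hl
  have hDX : ∀ x ∈ U, ContDiffAt ℝ ∞ (covDeriv m h X) x := fun x hx =>
    contDiffAt_covDeriv m (hd x hx) (hi x hx) (hX' x hx) (by simp) le_rfl
  refine blade.repr.injective (Finsupp.ext fun I => ?_)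
  rw [repr_gradePart, map_zero, Finsupp.zero_apply]
  split_ifs with hI
  · have hcont : ContinuousOn (fun x => (h x).det * scalarProd (blade I)
        (derivFst S (covDeriv m h) l X x
          - covDeriv m' h (derivSnd T (covDeriv m h) l X) x)) U := by
      intro x hx
      have c1 := contDiffAt_derivFst S ((hX' x hx).of_le (by simp : (1 : WithTop ℕ∞) ≤ ∞))
        ((hDX x hx).of_le (by simp)) (hl' x hx)
      have c2 := contDiffAt_covDeriv m' (hd x hx) (hi x hx) (contDiffAt_derivSnd T
        ((hX' x hx).of_le (by simp)) ((hDX x hx).of_le (by simp)) (hl' x hx)) (k := 0) (by simp)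
        (by simp)
      exact ((contDiffAt_det (hd x hx)).continuousAt.mul (contDiffAt_linear (scalarProd (blade I))
        ((c1.of_le (by simp)).sub c2)).continuousAt).continuousWithinAt
    have h0 := eq_zero_of_integral_mul_eq_zero hU hcont (fun φ hφ hc hφU =>
      integral_mul_eulerLagrange_eq_zero hU hh hinv hX hm hm' hmm' hl hstat
        (blade_mem_gradeSpace hI) hφ hc hφU) x hx
    rw [scalarProd_blade_left] at h0
    have hη : (∏ i ∈ I, eta i) ≠ 0 := Finset.prod_ne_zero_iff.2 fun i _ => eta_ne_zero i
    simpa [det_ne_zero (hinv x hx), hη] using h0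
  · rfl

/-- Components outside `T` vanish identically, hence so do their derivatives, and commutators with a
bivector preserve grades. -/
theorem gaugeDeriv_mem_gradeSpace {Y : Form1 → Multiform} (hY : ∀ y, Y y ∈ gradeSpace T)
    {x : Form1} (hd : DifferentiableAt ℝ Y x) (a : Form1) :
    gaugeDeriv h a Y x ∈ gradeSpace T := by
  refine Submodule.add_mem _ (fun I hI => ?_) (commutator_Omega_mem_gradeSpace _ (hY x))
  have h1 := fderiv_linear (blade.coord I) hd a
  have h2 : (fun y => blade.coord I (Y y)) = fun _ => 0 := funext fun y => hY y I hI
  rw [h2, fderiv_const_apply] at h1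
  exact h1.symm

/-- If the field of the Euler–Lagrange equation has grades in `S`, the equation holds without
projection onto these grades. -/
theorem eulerLagrange_eq_zero (hU : IsOpen U) (hh : ContDiffOn ℝ ∞ h U)
    (hinv : ∀ x ∈ U, (h x).IsInvertible) (hX : ContDiffOn ℝ ∞ X U)
    (hm : ∀ (a : Form1) {X : Multiform}, X ∈ gradeSpace S → m a X ∈ gradeSpace T)
    (hm' : IsRotationInvariant m')
    (hm'S : ∀ (a : Form1) {X : Multiform}, X ∈ gradeSpace T → m' a X ∈ gradeSpace S)
    (hmm' : ∀ a X Y, scalarProd (m a X) Y = scalarProd X (m' a Y))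
    (hl : ∀ x ∈ U, ContDiffAt ℝ 2 l (X x, covDeriv m h X x))
    (hstat : IsStationary S U h (covDeriv m h) l X) {x : Form1} (hx : x ∈ U) :
    derivFst S (covDeriv m h) l X x
      - covDeriv m' h (derivSnd T (covDeriv m h) l X) x = 0 := by
  rw [← gradePart_eulerLagrange_eq_zero hU hh hinv hX hm hm' hmm' hl hstat hx, eq_comm,
    gradePart_eq_self_iff]
  have hd := hh.contDiffAt (hU.mem_nhds hx)
  have hX' := hX.contDiffAt (hU.mem_nhds hx)
  have hDX : ContDiffAt ℝ ∞ (covDeriv m h X) x :=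
    contDiffAt_covDeriv m hd (Filter.mem_of_superset (hU.mem_nhds hx) hinv) hX' (by simp) le_rfl
  have hY := contDiffAt_derivSnd T (hX'.of_le (by simp)) (hDX.of_le (by simp))
    (Filter.mem_of_superset (hU.mem_nhds hx) hl)
  refine Submodule.sub_mem _ (multiformDeriv_mem_gradeSpace _ _ _)
    (Submodule.sum_mem _ fun μ _ => hm'S _ (gaugeDeriv_mem_gradeSpace
      (fun y => multiformDeriv_mem_gradeSpace _ _ _) (hY.differentiableAt (by simp)) _))

end EulerLagrange

/-- Each Clifford multiplication by a 1-form shifts grades by one, so two of them preserve parity.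
-/
theorem lowerGrades_union_raiseGrades_subset {S : Finset ℕ}
    (hS : ∀ p ∈ S, ∀ q ∈ Finset.range 5, Even (p + q) → q ∈ S) :
    lowerGrades (lowerGrades S ∪ raiseGrades S) ∪ raiseGrades (lowerGrades S ∪ raiseGrades S)
      ⊆ S := by
  have key : ∀ p, p ∈ lowerGrades S ∪ raiseGrades S → ∃ q ∈ S, Odd (p + q) := by
    intro p hp
    rcases Finset.mem_union.1 hp with hp | hp
    · exact ⟨p + 1, (Finset.mem_filter.1 hp).2, p, by ring⟩
    · obtain ⟨-, q, hq, rfl⟩ := Finset.mem_filter.1 hp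
      exact ⟨q, hq, q, by ring⟩
  intro p hp
  rcases Finset.mem_union.1 hp with hp | hp
  · obtain ⟨hp5, hp1⟩ := Finset.mem_filter.1 hp
    obtain ⟨q, hq, r, hr⟩ := key _ hp1
    exact hS q hq p hp5 ⟨r, by omega⟩
  · obtain ⟨hp5, p', hp', rfl⟩ := Finset.mem_filter.1 hp
    obtain ⟨q, hq, r, hr⟩ := key _ hp'
    exact hS q hq _ hp5 ⟨r + 1, by omega⟩

end GaugeELE
end

/-! ### The three kinds of Lagrangian. -/

open GaugeELE
theorem mainTheorem2
    (U : Set Form1) (hU : IsOpen U)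
    (h : Form1 → Form1 →L[ℝ] Form1) (hh : ContDiffOn ℝ ∞ h U)
    (hinv : ∀ x ∈ U, (h x).IsInvertible)
    (S : Finset ℕ) (hS : S ⊆ Finset.range 5)
    (X : Form1 → Multiform) (hX : ContDiffOn ℝ ∞ X U)
    (hXS : ∀ x ∈ U, gradePart S (X x) = X x)
    (l : Multiform × Multiform → ℝ) :
    ((∀ x ∈ U, ContDiffAt ℝ 2 l (X x, hDiv h X x)) → IsStationary S U h (hDiv h) l X →
      ∀ x ∈ U, derivFst S (hDiv h) l X x
        - hCurl h (derivSnd (lowerGrades S) (hDiv h) l X) x = 0) ∧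
    ((∀ x ∈ U, ContDiffAt ℝ 2 l (X x, hCurl h X x)) → IsStationary S U h (hCurl h) l X →
      ∀ x ∈ U, derivFst S (hCurl h) l X x
        - hDiv h (derivSnd (raiseGrades S) (hCurl h) l X) x = 0) ∧
    ((∀ x ∈ U, ContDiffAt ℝ 2 l (X x, hGrad h X x)) → IsStationary S U h (hGrad h) l X →
      (∀ x ∈ U, gradePart S (derivFst S (hGrad h) l X x
        - hGrad h (derivSnd (lowerGrades S ∪ raiseGrades S) (hGrad h) l X) x) = 0) ∧
      ((∀ p ∈ S, ∀ q ∈ Finset.range 5, Even (p + q) → q ∈ S) →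
        ∀ x ∈ U, derivFst S (hGrad h) l X x
          - hGrad h (derivSnd (lowerGrades S ∪ raiseGrades S) (hGrad h) l X) x = 0)) := by
  rw [hDiv_eq_covDeriv, hCurl_eq_covDeriv, hGrad_eq_covDeriv]
  refine ⟨fun hl hstat x hx => ?_, fun hl hstat x hx => ?_, fun hl hstat =>
    ⟨fun x hx => ?_, fun hpar x hx => ?_⟩⟩
  · exact eulerLagrange_eq_zero hU hh hinv hX (fun a _ hA => contractL_mem_gradeSpace a hA)
      isRotationInvariant_wedgeL
      (fun a _ hA => gradeSpace_mono (raiseGrades_lowerGrades_subset S)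
        (wedgeL_mem_gradeSpace a hA)) scalarProd_contractL hl hstat hx
  · exact eulerLagrange_eq_zero hU hh hinv hX (fun a _ hA => wedgeL_mem_gradeSpace a hA)
      isRotationInvariant_contractL
      (fun a _ hA => gradeSpace_mono (lowerGrades_raiseGrades_subset S)
        (contractL_mem_gradeSpace a hA)) scalarProd_wedgeL hl hstat hx
  · exact gradePart_eulerLagrange_eq_zero hU hh hinv hX (fun a _ hA => mulL_mem_gradeSpace a hA)
      isRotationInvariant_mulL scalarProd_mulL hl hstat hx
  · exact eulerLagrange_eq_zero hU hh hinv hX (fun a _ hA => mulL_mem_gradeSpace a hA)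
      isRotationInvariant_mulL
      (fun a _ hA => gradeSpace_mono (lowerGrades_union_raiseGrades_subset hpar)
        (mulL_mem_gradeSpace a hA)) scalarProd_mulL hl hstat hx
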